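/- **Setting.** A tile in $\mathbb{R}^2$ is a pair $\tau=(\mathrm{spt}(\tau),m)$ of a support $\mathrm{spt}(\tau)\subset\mathbb{R}^2$ and a mark $m$; it is translated by translating its support. A patch is a collection of tiles with pairwise disjoint interiors, and a tiling is a patch whose supports cover $\mathbb{R}^2$. Let $\rho_1,\dots,\rho_k$ be translationally inequivalent tiles (prototiles) whose supports are convex polygons with nonempty interior, let $\lambda>1$, and let $\Phi$ assign to each $\rho_i$ a patch $\Phi(\rho_i)$ of translates of prototiles with $\mathrm{spt}(\Phi(\rho_i))=\lambda\,\mathrm{spt}(\rho_i)$ (a self-similar substitution). Extend $\Phi$ to collections of translates of prototiles by $\Phi(\{\rho_{i(j)}+v_j\}_j)=\bigcup_j(\Phi(\rho_{i(j)})+\lambda v_j)$. A patch is allowed if it is contained in a translate of some $\Phi^m(\rho_i)$, $m\ge1$; the tiling space $\Omega_\Phi$ is the set of tilings all of whose finite patches are allowed. With $B_R[T]$ the set of tiles of $T$ meeting the open ball of radius $R$ about $0$, let $d(T,T')$ be the infimum of $1$ and of all $\epsilon>0$ for which there are $v,v'$ with $|v|,|v'|<\epsilon/2$ and $B_{1/\epsilon}[T-v]=B_{1/\epsilon}[T'-v']$.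 Assume that $\Phi$ is primitive (for all $i,j$ a translate of $\rho_i$ occurs in $\Phi^n(\rho_j)$ for some $n$), that $\Omega_\Phi$ has translationally finite local complexity (for each $R$ only finitely many patches of diameter at most $R$, up to translation, occur in tilings of $\Omega_\Phi$), and that $\Omega_\Phi$ is non-periodic ($T\in\Omega_\Phi$ and $T-v=T$ imply $v=0$). **Definitions.** Write $T\sim_sT'$ if $d(\Phi^n(T),\Phi^n(T'))\to0$ as $n\to\infty$. A pair $(T,T')\in\Omega_\Phi\times\Omega_\Phi$ is a branch pair if $T\nsim_sT'$ and there is an open half-plane $H=\{x:\langle x,u\rangle>0\}$, $|u|=1$, with $T-x\sim_sT'-x$ for all $x\in H$. Its asymptotic sector $S(T,T')$ is the connected component of $\{v\in\mathbb{S}^1: T-tv\sim_sT'-tv\ \ \forall t>0\}$ containing $H\cap\mathbb{S}^1$ (if several $H$ give different sectors, all of them are considered), and $\partial S(T,T')$ is its boundary in $\mathbb{S}^1$. Let $\mathcal{BP}$ be the set of branch pairs and $\mathcal{PBP}$ the set of branch pairs $(T,T')$ with $\Phi^k(T)=T$ for some $k\ge1$. Let $\tilde\partial S(T,T')$ be the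 set of $v\in\partial S(T,T')$ for which there are $t_i\to\infty$ with $T-t_iv\nsim_sT'-t_iv$. The branch locus and the periodic branch locus are $$\mathcal{BL}(\Phi)=\bigcup_{(T,T')\in\mathcal{BP}}\mathrm{cl}\Big(\{T\}\cup\bigcup_{t\ge0,\ v\in\tilde\partial S(T,T')}\{T-tv\}\Big),\qquad \mathcal{PBL}(\Phi)=\bigcup_{(T,T')\in\mathcal{PBP}}\mathrm{cl}\Big(\{T\}\cup\bigcup_{t\ge0,\ v\in\tilde\partial S(T,T')}\{T-tv\}\Big),$$ with closures taken in $(\Omega_\Phi,d)$. Finally, $\mathcal{BP}$ is non-collapsing if, whenever $(T,T')\in\mathcal{BP}$, $v\in\partial S(T,T')$ and $0\le t_0<t_1$ are such that $T-t_0v\nsim_sT'-t_0v$ and $T-t_1v\nsim_sT'-t_1v$, one has $T-tv\nsim_sT'-tv$ for all $t\in[t_0,t_1]$. **Proposition.** If $\mathcal{BP}$ is non-collapsing, then $\mathcal{PBL}(\Phi)=\mathcal{BL}(\Phi)$. The same equality holds if the singletons $\{T\}$ are omitted from both definitions. -/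

import Mathlib

open Filter Topology

namespace SubstTiling

/-- Euclidean `d`-space. -/
abbrev Space (d : ℕ) : Type := EuclideanSpace ℝ (Fin d)

/-- The unit sphere of directions in `ℝ^d`. -/
abbrev Direction (d : ℕ) : Type := Metric.sphere (0 : Space d) 1

/-- A tile is a support together with a mark.  (Compactness and topological regularity of supports
are required of the prototiles, of which all tiles under consideration are translates.) -/
@[ext]
structure Tile (d : ℕ) (M : Type*) where
  support : Set (Space d)
  mark : M

variable {d : ℕ} {M ι : Type*}

/-- The translate `τ + v`. -/
def Tile.translate (τ : Tile d M) (v : Space d) : Tile d M :=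
  ⟨(fun x => x + v) '' τ.support, τ.mark⟩

/-- The translate `P + v` of a collection of tiles. -/
def translate (P : Set (Tile d M)) (v : Space d) : Set (Tile d M) :=
  (fun τ => τ.translate v) '' P

/-- The translate `P - v` of a collection of tiles. -/
def shift (P : Set (Tile d M)) (v : Space d) : Set (Tile d M) :=
  translate P (-v)

/-- The support of a collection of tiles: the union of the supports of its members. -/
def supp (P : Set (Tile d M)) : Set (Space d) :=
  ⋃ τ ∈ P, τ.support

/-- A patch is a collection of tiles with pairwise disjoint interiors. -/
def IsPatch (P : Set (Tile d M)) : Prop :=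
  P.Pairwise fun σ τ => Disjoint (interior σ.support) (interior τ.support)

/-- A tiling is a patch with support `ℝ^d`. -/
def IsTiling (T : Set (Tile d M)) : Prop :=
  IsPatch T ∧ supp T = Set.univ

/-- `B_R[T]`: the tiles of `T` whose support meets the open ball of radius `R` about the origin. -/
def ballPatch (R : ℝ) (T : Set (Tile d M)) : Set (Tile d M) :=
  {τ ∈ T | (Metric.ball (0 : Space d) R ∩ τ.support).Nonempty}

/-- Up to translations by less than `ε / 2`, `T` and `T'` agree on the ball of radius `1 / ε`. -/
def Close (ε : ℝ) (T T' : Set (Tile d M)) : Prop :=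
  ∃ v v' : Space d, ‖v‖ < ε / 2 ∧ ‖v'‖ < ε / 2 ∧
    ballPatch (1 / ε) (shift T v) = ballPatch (1 / ε) (shift T' v')

/-- The tiling metric, truncated at `1`. -/
noncomputable def tilingDist (T T' : Set (Tile d M)) : ℝ :=
  sInf (insert 1 {ε : ℝ | 0 < ε ∧ Close ε T T'})

/-- The closure, relative to `Ω` and in the tiling metric, of a set `X` of tilings. -/
def tilingClosure (Ω X : Set (Set (Tile d M))) : Set (Set (Tile d M)) :=
  {T ∈ Ω | ∀ ε : ℝ, 0 < ε → ∃ T' ∈ X, tilingDist T T' < ε}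

/-- Translationally finite local complexity: for each `R`, up to translation, only finitely many
patches of diameter at most `R` occur in the members of `Ω`. -/
def HasFLC (Ω : Set (Set (Tile d M))) : Prop :=
  ∀ R : ℝ, ∃ F : Set (Set (Tile d M)), F.Finite ∧
    ∀ T ∈ Ω, ∀ P ⊆ T, (∀ x ∈ supp P, ∀ y ∈ supp P, dist x y ≤ R) →
      ∃ Q ∈ F, ∃ v : Space d, P = translate Q v

/-- The translation action on `Ω` is free. -/
def IsNonPeriodic (Ω : Set (Set (Tile d M))) : Prop :=
  ∀ T ∈ Ω, ∀ v : Space d, shift T v = T → v = 0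

/-- A convex polygon: the convex hull of a finite set, with nonempty interior. -/
def IsConvexPolygon (K : Set (Space 2)) : Prop :=
  (∃ s : Set (Space 2), s.Finite ∧ K = convexHull ℝ s) ∧ (interior K).Nonempty

end SubstTiling

/-- A self-similar substitution: pairwise translationally inequivalent prototiles indexed by `ι`,
an expansion factor `ratio > 1`, and for each prototile `ρ` a patch of translates of prototiles
whose support is `ratio • spt ρ`. -/
structure SelfSimilarSubstitution (d : ℕ) (M ι : Type*) where
  proto : ι → SubstTiling.Tile d M
  proto_compact : ∀ i, IsCompact (proto i).support
  proto_nonempty : ∀ i, (proto i).support.Nonempty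
  proto_regular : ∀ i, closure (interior (proto i).support) = (proto i).support
  proto_inequiv : ∀ i j v, (proto i).translate v = proto j → i = j
  ratio : ℝ
  one_lt_ratio : 1 < ratio
  subst : ι → Set (SubstTiling.Tile d M)
  subst_patch : ∀ i, SubstTiling.IsPatch (subst i)
  subst_proto : ∀ i, ∀ τ ∈ subst i, ∃ j v, τ = (proto j).translate v
  subst_supp : ∀ i, SubstTiling.supp (subst i) = (fun x => ratio • x) '' (proto i).support

namespace SelfSimilarSubstitution

open SubstTiling

variable {d : ℕ} {M ι : Type*} (Φ : SelfSimilarSubstitution d M ι)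

/-- The extension of the substitution to collections of translates of prototiles:
`Φ({ρ_{i(j)} + v_j}) = ⋃_j (Φ(ρ_{i(j)}) + ratio • v_j)`. -/
def app (P : Set (Tile d M)) : Set (Tile d M) :=
  {σ | ∃ i v, (Φ.proto i).translate v ∈ P ∧ σ ∈ translate (Φ.subst i) (Φ.ratio • v)}

/-- A patch is allowed if some translate of it is contained in some `Φ^m(ρ_i)`, `m ≥ 1`. -/
def Allowed (P : Set (Tile d M)) : Prop :=
  ∃ m : ℕ, 1 ≤ m ∧ ∃ (i : ι) (v : Space d), P ⊆ shift (Φ.app^[m] {Φ.proto i}) v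

/-- The substitution tiling space: the tilings all of whose finite patches are allowed. -/
def tilingSpace : Set (Set (Tile d M)) :=
  {T | IsTiling T ∧ ∀ P ⊆ T, P.Finite → Φ.Allowed P}

/-- Primitivity: for all `i, j` a translate of `ρ_i` occurs in some `Φ^n(ρ_j)`. -/
def IsPrimitive : Prop :=
  ∀ i j : ι, ∃ (n : ℕ) (v : Space d), (Φ.proto i).translate v ∈ Φ.app^[n] {Φ.proto j}

/-- Stable equivalence `T ∼ₛ T'`: the distance of `Φ^n(T)` and `Φ^n(T')` tends to `0`. -/
def StablyEquiv (T T' : Set (Tile d M)) : Prop :=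
  Tendsto (fun n : ℕ => tilingDist (Φ.app^[n] T) (Φ.app^[n] T')) atTop (𝓝 0)

/-- `T - x ∼ₛ T' - x` for all `x` in the open half-space `{x | ⟪x, u⟫ > 0}`. -/
def StableOnHalfSpace (T T' : Set (Tile d M)) (u : Direction d) : Prop :=
  ∀ x : Space d, 0 < inner ℝ x (u : Space d) → Φ.StablyEquiv (shift T x) (shift T' x)

/-- The set of branch pairs. -/
def branchPairs : Set (Set (Tile d M) × Set (Tile d M)) :=
  {p | p.1 ∈ Φ.tilingSpace ∧ p.2 ∈ Φ.tilingSpace ∧ ¬ Φ.StablyEquiv p.1 p.2 ∧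
    ∃ u : Direction d, Φ.StableOnHalfSpace p.1 p.2 u}

/-- `T` is periodic under the substitution. -/
def IsSubstPeriodic (T : Set (Tile d M)) : Prop :=
  ∃ k : ℕ, 1 ≤ k ∧ Φ.app^[k] T = T

/-- The set of periodic branch pairs: the branch pairs `(T, T')` with `T` periodic. -/
def periodicBranchPairs : Set (Set (Tile d M) × Set (Tile d M)) :=
  {p ∈ Φ.branchPairs | Φ.IsSubstPeriodic p.1}

/-- The directions `v` with `T - tv ∼ₛ T' - tv` for all `t > 0`. -/
def stableDirections (T T' : Set (Tile d M)) : Set (Direction d) :=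
  {v | ∀ t : ℝ, 0 < t → Φ.StablyEquiv (shift T (t • (v : Space d))) (shift T' (t • (v : Space d)))}

/-- `S` is an asymptotic sector of `(T, T')`: the connected component of the set of stable
directions that contains the open hemisphere about `u`, for some half-space `{x | ⟪x, u⟫ > 0}`
on which `T` and `T'` are stably equivalent.  (The hemisphere is connected and contains `u`, so
this is the component of `u`.) -/
def IsSector (T T' : Set (Tile d M)) (S : Set (Direction d)) : Prop :=
  ∃ u : Direction d, Φ.StableOnHalfSpace T T' u ∧
    S = connectedComponentIn (Φ.stableDirections T T') u

/-- The boundary directions `v` of an asymptotic sector of `(T, T')` (boundary taken in the unit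
sphere) along which there are `t_i → ∞` such that `T - t_i v` and `T' - t_i v` are not stably
equivalent. -/
def branchDirections (T T' : Set (Tile d M)) : Set (Direction d) :=
  {v | (∃ S, Φ.IsSector T T' S ∧ v ∈ frontier S) ∧
    ∃ t : ℕ → ℝ, Tendsto t atTop atTop ∧
      ∀ i, ¬ Φ.StablyEquiv (shift T (t i • (v : Space d))) (shift T' (t i • (v : Space d)))}

/-- The branch pairs are non-collapsing. -/
def NonCollapsing : Prop :=
  ∀ T T' : Set (Tile d M), (T, T') ∈ Φ.branchPairs →
    ∀ S, Φ.IsSector T T' S → ∀ v ∈ frontier S, ∀ t₀ t₁ : ℝ, 0 ≤ t₀ → t₀ < t₁ →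
      ¬ Φ.StablyEquiv (shift T (t₀ • (v : Space d))) (shift T' (t₀ • (v : Space d))) →
      ¬ Φ.StablyEquiv (shift T (t₁ • (v : Space d))) (shift T' (t₁ • (v : Space d))) →
      ∀ t ∈ Set.Icc t₀ t₁,
        ¬ Φ.StablyEquiv (shift T (t • (v : Space d))) (shift T' (t • (v : Space d)))

/-- The tilings `T - tv` with `t ≥ 0` and `v` a branch direction of `(T, T')`. -/
def branchRays (T T' : Set (Tile d M)) : Set (Set (Tile d M)) :=
  {X | ∃ v ∈ Φ.branchDirections T T', ∃ t : ℝ, 0 ≤ t ∧ X = shift T (t • (v : Space d))}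

/-- The part of the tiling space carried by a set `B` of branch pairs: the union, over
`(T, T') ∈ B`, of the closure of `{T}` together with the branch rays of `(T, T')`.  (The point `T`
lies on the rays as soon as there is one; it has to be adjoined for pairs, such as those that are
asymptotic in all directions, that have no branch direction.) -/
def locus (B : Set (Set (Tile d M) × Set (Tile d M))) : Set (Set (Tile d M)) :=
  ⋃ p ∈ B, tilingClosure Φ.tilingSpace (insert p.1 (Φ.branchRays p.1 p.2))

/-- The variant of `locus` in which pairs without branch directions contribute nothing. -/
def rayLocus (B : Set (Set (Tile d M) × Set (Tile d M))) : Set (Set (Tile d M)) :=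
  ⋃ p ∈ B, tilingClosure Φ.tilingSpace (Φ.branchRays p.1 p.2)

/-- The branch locus. -/
def branchLocus : Set (Set (Tile d M)) := Φ.locus Φ.branchPairs

/-- The periodic branch locus. -/
def periodicBranchLocus : Set (Set (Tile d M)) := Φ.locus Φ.periodicBranchPairs

/-- The branch locus formed from rays only. -/
def branchRayLocus : Set (Set (Tile d M)) := Φ.rayLocus Φ.branchPairs

/-- The periodic branch locus formed from rays only. -/
def periodicBranchRayLocus : Set (Set (Tile d M)) := Φ.rayLocus Φ.periodicBranchPairs

end SelfSimilarSubstitution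

/-! Everything is reduced to a combinatorial form of stable equivalence: `T - x ∼ₛ T' - x` exactly
when, for some `n`, `Φ^n(T)` and `Φ^n(T')` have the same tiles at the point `ratio ^ n • x`
(`stablyEquiv_shift_iff`). This condition, `EventuallyAgree T T' x`, is open in `x`, depends only on
the tiles at `x`, and scales with the substitution.

One inclusion holds because periodic branch pairs are branch pairs. For the other, let `X` lie in
the branch locus. Non-collapsing makes every point of a branch ray the first component of a branch
pair, with a half-plane bounded by the line of the ray (`exists_halfPlane_of_mem_branchDirections`).
Branch pairs pass to limits in their first component (`exists_limit_pair`), so `X` itself belongs to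
a branch pair.

It remains to treat one branch pair `(T, T')` (`periodic_or_mem_closure_branchRays`). Desubstitute
both tilings to pairs `(S n, S' n)` with `Φ^n(S n) = T`. By recurrence, two of these pairs, `k`
steps apart, look alike near the origin up to one small common translation, which must be parallel
to the boundary line of the half-plane. After a correction of the origin, `Φ^k` fixes this local
picture, and iterating it yields a periodic pair. A bounded power `(Q, Q')` of it is a branch pair
such that, on balls of radius `ratio ^ i / 2`, `T` is `Q` shifted along the boundary line. If the
shift vanishes for arbitrarily large `i`, then `T = Q` is periodic; otherwise the shifts are points
of branch rays of `(Q, Q')`, and they converge to `T`.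

Both limit arguments need the two members of a pair to be rigidly tied together. This is
`exists_agreeAt_halfSpace`: eventual agreement on a half-space forces actual agreement beyond a
distance `c` independent of the pair, so the members share a tile near the origin. It follows from
the uniform bound `exists_uniform_agreeAt`, which rests on non-periodicity through
`exists_repulsion`. -/

namespace SubstTiling

/-! ### Translation and pointwise agreement of collections of tiles. -/

variable {d : ℕ} {M : Type*}

theorem Tile.mem_support_translate {τ : Tile d M} {v x : Space d} :
    x ∈ (τ.translate v).support ↔ x - v ∈ τ.support := by
  constructor
  · rintro ⟨y, hy, rfl⟩
    simpa using hy
  · intro h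
    exact ⟨x - v, h, by simp⟩

@[simp]
theorem Tile.translate_zero (τ : Tile d M) : τ.translate 0 = τ := by
  ext x
  · simp [Tile.mem_support_translate]
  · rfl

@[simp]
theorem Tile.translate_translate (τ : Tile d M) (v w : Space d) :
    (τ.translate v).translate w = τ.translate (v + w) := by
  ext x
  · simp only [Tile.mem_support_translate]
    rw [sub_sub, add_comm w v]
  · rfl

theorem Tile.interior_support_translate {τ : Tile d M} {v x : Space d} :
    x ∈ interior (τ.translate v).support ↔ x - v ∈ interior τ.support := by
  have h : (τ.translate v).support = (Homeomorph.addRight v) '' τ.support := rfl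
  rw [h, ← Homeomorph.image_interior]
  constructor
  · rintro ⟨y, hy, rfl⟩
    simpa using hy
  · intro h
    exact ⟨x - v, h, by simp⟩

theorem mem_translate {P : Set (Tile d M)} {v : Space d} {τ : Tile d M} :
    τ ∈ translate P v ↔ τ.translate (-v) ∈ P := by
  constructor
  · rintro ⟨σ, hσ, rfl⟩
    simpa using hσ
  · intro h
    exact ⟨_, h, by simp⟩

@[simp]
theorem translate_zero (P : Set (Tile d M)) : translate P 0 = P := by
  ext τ
  simp [mem_translate]

@[simp]
theorem translate_translate (P : Set (Tile d M)) (v w : Space d) :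
    translate (translate P v) w = translate P (v + w) := by
  ext τ
  simp only [mem_translate, Tile.translate_translate]
  rw [neg_add_rev]

theorem translate_mono {P Q : Set (Tile d M)} (h : P ⊆ Q) (v : Space d) :
    translate P v ⊆ translate Q v :=
  Set.image_mono h

theorem shift_eq (P : Set (Tile d M)) (v : Space d) : shift P v = translate P (-v) := rfl

/-- A tile with nonempty bounded support is not fixed by a nonzero translation. -/
theorem Tile.translate_injective {τ : Tile d M} (hb : Bornology.IsBounded τ.support)
    (hne : τ.support.Nonempty) {v w : Space d} (h : τ.translate v = τ.translate w) : v = w := by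
  obtain ⟨x, hx⟩ := hne
  -- Iterating the equality puts a whole arithmetic progression of step `v - w` into the bounded
  -- support.
  have key : ∀ n : ℕ, x + (n : ℝ) • (v - w) ∈ τ.support := by
    intro n
    induction n with
    | zero => simpa using hx
    | succ n ih =>
      have h1 : x + (n : ℝ) • (v - w) + v ∈ (τ.translate v).support := by
        rw [Tile.mem_support_translate]; simpa using ih
      rw [h, Tile.mem_support_translate] at h1
      convert h1 using 1
      push_cast
      module
  obtain ⟨C, hC⟩ := hb.exists_norm_le
  by_contra hvw
  have hpos : 0 < ‖v - w‖ := norm_pos_iff.2 (sub_ne_zero.2 hvw)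
  obtain ⟨n, hn⟩ := exists_nat_gt ((C + ‖x‖) / ‖v - w‖)
  rw [div_lt_iff₀ hpos] at hn
  have h2 := hC _ (key n)
  have h3 : ‖(n : ℝ) • (v - w)‖ ≤ ‖x + (n : ℝ) • (v - w)‖ + ‖x‖ := by
    have := norm_sub_le (x + (n : ℝ) • (v - w)) x
    simpa using this
  rw [norm_smul, Real.norm_natCast] at h3
  linarith

theorem IsPatch.translate {P : Set (Tile d M)} (hP : IsPatch P) (v : Space d) :
    IsPatch (translate P v) := by
  intro σ hσ τ hτ hne
  rw [mem_translate] at hσ hτ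
  have h := Set.disjoint_left.1
    (hP hσ hτ fun h => hne (by simpa using congrArg (fun t => Tile.translate t v) h))
  refine Set.disjoint_left.2 ?_
  intro x hx hx'
  refine @h (x - v) ?_ ?_ <;> rw [Tile.interior_support_translate] <;> simpa

theorem IsTiling.translate {T : Set (Tile d M)} (hT : IsTiling T) (v : Space d) :
    IsTiling (translate T v) := by
  refine ⟨hT.1.translate v, Set.eq_univ_of_forall fun x => ?_⟩
  have hx : x - v ∈ supp T := hT.2 ▸ Set.mem_univ _
  simp only [supp, Set.mem_iUnion] at hx ⊢
  obtain ⟨τ, hτ, hx⟩ := hx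
  exact ⟨τ.translate v, ⟨τ, hτ, rfl⟩, Tile.mem_support_translate.2 hx⟩

theorem IsTiling.exists_mem {T : Set (Tile d M)} (hT : IsTiling T) (x : Space d) :
    ∃ τ ∈ T, x ∈ τ.support := by
  have hx : x ∈ supp T := hT.2 ▸ Set.mem_univ _
  simpa [supp] using hx

/-- The collections `T` and `T'` have the same tiles at the point `x`. -/
def AgreeAt (T T' : Set (Tile d M)) (x : Space d) : Prop :=
  ∀ τ : Tile d M, x ∈ τ.support → (τ ∈ T ↔ τ ∈ T')

theorem AgreeAt.refl (T : Set (Tile d M)) (x : Space d) : AgreeAt T T x := fun _ _ => Iff.rfl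

theorem AgreeAt.symm {T T' : Set (Tile d M)} {x : Space d} (h : AgreeAt T T' x) :
    AgreeAt T' T x := fun τ hτ => (h τ hτ).symm

theorem AgreeAt.trans {T T' T'' : Set (Tile d M)} {x : Space d} (h : AgreeAt T T' x)
    (h' : AgreeAt T' T'' x) : AgreeAt T T'' x := fun τ hτ => (h τ hτ).trans (h' τ hτ)

theorem agreeAt_translate {T T' : Set (Tile d M)} {v x : Space d} :
    AgreeAt (translate T v) (translate T' v) x ↔ AgreeAt T T' (x - v) := by
  constructor
  · intro h τ hτ
    have := h (τ.translate v) (Tile.mem_support_translate.2 hτ)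
    simpa [mem_translate] using this
  · intro h τ hτ
    rw [mem_translate, mem_translate]
    exact h _ (by rw [Tile.mem_support_translate]; simpa [sub_eq_add_neg] using hτ)

/-- A tile belongs to the ball patch as soon as it meets the ball, so each tile can be tested at a
single point. This turns the metric into pointwise agreement. -/
theorem ballPatch_eq_iff {R : ℝ} {T T' : Set (Tile d M)} :
    ballPatch R T = ballPatch R T' ↔ ∀ x, ‖x‖ < R → AgreeAt T T' x := by
  constructor
  · intro h x hx τ hτ
    have hne : (Metric.ball (0 : Space d) R ∩ τ.support).Nonempty := ⟨x, by simpa using hx, hτ⟩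
    have := Set.ext_iff.1 h τ
    simpa [ballPatch, hne] using this
  · intro h
    ext τ
    simp only [ballPatch, Set.mem_ofPred_eq]
    refine and_congr_left fun hne => ?_
    obtain ⟨x, hx, hτ⟩ := hne
    exact h x (by simpa using hx) τ hτ

theorem mem_ballPatch {R : ℝ} {T : Set (Tile d M)} {τ : Tile d M} {x : Space d} (hτ : τ ∈ T)
    (hx : x ∈ τ.support) (hxR : ‖x‖ < R) : τ ∈ ballPatch R T :=
  ⟨hτ, x, by simpa using hxR, hx⟩

theorem ballPatch_subset (R : ℝ) (T : Set (Tile d M)) : ballPatch R T ⊆ T := fun _ h => h.1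

theorem eq_of_agreeAt {T T' : Set (Tile d M)} (hT : ∀ τ ∈ T, τ.support.Nonempty)
    (hT' : ∀ τ ∈ T', τ.support.Nonempty) (h : ∀ x, AgreeAt T T' x) : T = T' := by
  ext τ
  constructor
  · intro hτ
    obtain ⟨x, hx⟩ := hT τ hτ
    exact (h x τ hx).1 hτ
  · intro hτ
    obtain ⟨x, hx⟩ := hT' τ hτ
    exact (h x τ hx).2 hτ

end SubstTiling

/-! ### Collections of translates of prototiles: separation, finiteness, and the substitution. -/

namespace SelfSimilarSubstitution

open SubstTiling

variable {d : ℕ} {M ι : Type*} (Φ : SelfSimilarSubstitution d M ι)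

theorem ratio_pos : 0 < Φ.ratio := zero_lt_one.trans Φ.one_lt_ratio

theorem proto_translate_injective {i j : ι} {v w : Space d}
    (h : (Φ.proto i).translate v = (Φ.proto j).translate w) : i = j ∧ v = w := by
  have h1 : (Φ.proto i).translate (v - w) = Φ.proto j := by
    have := congrArg (fun t => Tile.translate t (-w)) h
    simpa [sub_eq_add_neg] using this
  obtain rfl := Φ.proto_inequiv i j _ h1
  exact ⟨rfl, Tile.translate_injective (Φ.proto_compact i).isBounded (Φ.proto_nonempty i) h⟩

theorem exists_mem_interior (i : ι) : ∃ c, c ∈ interior (Φ.proto i).support := by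
  by_contra! h
  have h1 := Φ.proto_regular i
  rw [Set.eq_empty_of_forall_notMem h, closure_empty] at h1
  exact (Φ.proto_nonempty i).ne_empty h1.symm

/-- All members of `P` are translates of prototiles. -/
def Generated (P : Set (Tile d M)) : Prop := ∀ τ ∈ P, ∃ i v, τ = (Φ.proto i).translate v

variable {Φ}

theorem Generated.mono {P Q : Set (Tile d M)} (hP : Φ.Generated P) (h : Q ⊆ P) : Φ.Generated Q :=
  fun τ hτ => hP τ (h hτ)

theorem Generated.translate {P : Set (Tile d M)} (hP : Φ.Generated P) (v : Space d) :
    Φ.Generated (translate P v) := by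
  rintro _ ⟨τ, hτ, rfl⟩
  obtain ⟨i, w, rfl⟩ := hP τ hτ
  exact ⟨i, w + v, by simp⟩

theorem generated_proto (i : ι) : Φ.Generated {Φ.proto i} := by
  rintro _ rfl
  exact ⟨i, 0, by simp⟩

theorem Generated.isCompact {P : Set (Tile d M)} (hP : Φ.Generated P) {τ : Tile d M} (hτ : τ ∈ P) :
    IsCompact τ.support := by
  obtain ⟨i, v, rfl⟩ := hP τ hτ
  exact (Φ.proto_compact i).image (continuous_id.add continuous_const)

theorem Generated.nonempty {P : Set (Tile d M)} (hP : Φ.Generated P) {τ : Tile d M} (hτ : τ ∈ P) :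
    τ.support.Nonempty := by
  obtain ⟨i, v, rfl⟩ := hP τ hτ
  exact (Φ.proto_nonempty i).image _

theorem Generated.mem_closure_interior {P : Set (Tile d M)} (hP : Φ.Generated P) {τ : Tile d M}
    (hτ : τ ∈ P) {x : Space d} (hx : x ∈ τ.support) : x ∈ closure (interior τ.support) := by
  obtain ⟨i, v, rfl⟩ := hP τ hτ
  rw [Tile.mem_support_translate, ← Φ.proto_regular i] at hx
  rw [mem_closure_iff_seq_limit] at hx ⊢
  obtain ⟨u, hu, hlim⟩ := hx
  refine ⟨fun n => u n + v, fun n => ?_, ?_⟩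
  · rw [Tile.interior_support_translate]
    simpa using hu n
  · simpa using hlim.add_const v

theorem Generated.translate_injective {P : Set (Tile d M)} (hP : Φ.Generated P) {τ : Tile d M}
    (hτ : τ ∈ P) {v w : Space d} (h : τ.translate v = τ.translate w) : v = w :=
  Tile.translate_injective (hP.isCompact hτ).isBounded (hP.nonempty hτ) h

/-- If a patch contains all tiles of a tiling that meet the ball of radius `R`, then it agrees with
the tiling on that ball. -/
theorem agreeAt_of_ballPatch_subset {T P : Set (Tile d M)} (hT : IsTiling T) (hTg : Φ.Generated T)
    (hP : IsPatch P) (hPg : Φ.Generated P) {R : ℝ} (h : ballPatch R T ⊆ P) {x : Space d}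
    (hx : ‖x‖ < R) : AgreeAt T P x := by
  intro τ hτ
  refine ⟨fun h' => h (mem_ballPatch h' hτ hx), fun h' => ?_⟩
  -- A tile of `P` at `x` has interior points inside the ball. The tile of `T` covering such a point
  -- also lies in `P`, and the two interiors meet, so the two tiles coincide.
  have h1 := hPg.mem_closure_interior h' hτ
  obtain ⟨y, hyb, hy⟩ := mem_closure_iff.1 h1 (Metric.ball 0 R) Metric.isOpen_ball (by simpa using hx)
  obtain ⟨σ, hσ, hyσ⟩ := hT.exists_mem y
  have hσP : σ ∈ P := h ⟨hσ, y, hyb, hyσ⟩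
  obtain ⟨z, hz, hzσ⟩ := mem_closure_iff.1 (hTg.mem_closure_interior hσ hyσ) _ isOpen_interior hy
  by_contra hne
  have : τ ≠ σ := fun h => hne (h ▸ hσ)
  exact Set.disjoint_left.1 (hP h' hσP this) hz hzσ

variable (Φ)

/-- Two translates of the same prototile in a patch whose distance is small coincide. -/
theorem exists_separation [Finite ι] : ∃ r : ℝ, 0 < r ∧ ∀ (P : Set (Tile d M)), IsPatch P →
    ∀ i v w, (Φ.proto i).translate v ∈ P → (Φ.proto i).translate w ∈ P → ‖v - w‖ < r → v = w := by
  have key : ∀ i, ∀ᶠ r in 𝓝[>] (0 : ℝ), ∀ (P : Set (Tile d M)), IsPatch P → ∀ v w,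
      (Φ.proto i).translate v ∈ P → (Φ.proto i).translate w ∈ P → ‖v - w‖ < r → v = w := by
    intro i
    obtain ⟨c, hc⟩ := Φ.exists_mem_interior i
    obtain ⟨r, hr, hball⟩ := Metric.isOpen_iff.1 isOpen_interior c hc
    filter_upwards [Ioo_mem_nhdsGT hr] with s hs P hP v w hv hw hvw
    by_contra hne
    have hne' : (Φ.proto i).translate v ≠ (Φ.proto i).translate w :=
      fun h => hne (Φ.proto_translate_injective h).2
    have hd := Set.disjoint_left.1 (hP hv hw hne')
    refine @hd (c + v) ?_ ?_
    · rw [Tile.interior_support_translate]; simpa using hc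
    · rw [Tile.interior_support_translate]
      apply hball
      rw [mem_ball_iff_norm]
      have : c + v - w - c = v - w := by abel
      rw [this]
      exact hvw.trans hs.2
  obtain ⟨r, hr, hr0⟩ := ((eventually_all.2 key).and self_mem_nhdsWithin).exists
  exact ⟨r, hr0, fun P hP i => hr i P hP⟩

theorem exists_tile_separation [Finite ι] : ∃ r : ℝ, 0 < r ∧ ∀ (P : Set (Tile d M)), IsPatch P →
    Φ.Generated P → ∀ (τ : Tile d M) (v w : Space d), τ.translate v ∈ P → τ.translate w ∈ P → ‖v - w‖ < r → v = w := by
  obtain ⟨r, hr, h⟩ := Φ.exists_separation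
  refine ⟨r, hr, fun P hP hPg τ v w hv hw hvw => ?_⟩
  obtain ⟨i, a, ha⟩ := hPg _ hv
  have hτ : τ = (Φ.proto i).translate (a - v) := by
    have := congrArg (fun t => Tile.translate t (-v)) ha
    simpa [sub_eq_add_neg] using this
  subst hτ
  simp only [Tile.translate_translate] at hv hw
  have := h P hP i _ _ hv hw (by rwa [add_sub_add_left_eq_sub])
  exact add_left_cancel this

theorem exists_norm_bound [Finite ι] : ∃ D : ℝ, 0 < D ∧ ∀ i, ∀ x ∈ (Φ.proto i).support, ‖x‖ ≤ D := by
  have key : ∀ i, ∀ᶠ D in (atTop : Filter ℝ), ∀ x ∈ (Φ.proto i).support, ‖x‖ ≤ D := by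
    intro i
    obtain ⟨C, hC⟩ := (Φ.proto_compact i).isBounded.exists_norm_le
    filter_upwards [eventually_ge_atTop C] with D hD x hx using (hC x hx).trans hD
  obtain ⟨D, hD, hD0⟩ := ((eventually_all.2 key).and (eventually_gt_atTop 0)).exists
  exact ⟨D, hD0, hD⟩

/-- A uniform bound for the diameters of the tiles. -/
theorem exists_diam_bound [Finite ι] : ∃ D : ℝ, 0 < D ∧ ∀ P, Φ.Generated P → ∀ τ ∈ P,
    ∀ x ∈ τ.support, ∀ y ∈ τ.support, ‖x - y‖ ≤ D := by
  obtain ⟨D, hD, h⟩ := Φ.exists_norm_bound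
  refine ⟨D + D, by positivity, fun P hP τ hτ x hx y hy => ?_⟩
  obtain ⟨i, v, rfl⟩ := hP τ hτ
  rw [Tile.mem_support_translate] at hx hy
  have := norm_sub_le (x - v) (y - v)
  simp only [sub_sub_sub_cancel_right] at this
  linarith [h i _ hx, h i _ hy]

variable {Φ}

/-- An infinite bounded set would accumulate somewhere, giving two distinct points at distance less
than `r`. -/
theorem finite_of_separated {s : Set (Space d)} {r R : ℝ} (hr : 0 < r) (hb : ∀ x ∈ s, ‖x‖ ≤ R)
    (hs : ∀ x ∈ s, ∀ y ∈ s, ‖x - y‖ < r → x = y) : s.Finite := by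
  by_contra hinf
  have hsub : s ⊆ Metric.closedBall 0 R := fun x hx => by simpa using hb x hx
  obtain ⟨x, -, hx⟩ := Set.Infinite.exists_accPt_of_subset_isCompact hinf
    (isCompact_closedBall _ _) hsub
  rw [accPt_iff_frequently] at hx
  have h1 := hx.and_eventually (Metric.ball_mem_nhds x (half_pos hr))
  obtain ⟨y, ⟨hyx, hys⟩, hy⟩ := h1.exists
  -- Taking `z` strictly closer to the accumulation point than `y` is what guarantees `z ≠ y`.
  have hpos : 0 < min (r / 2) ‖y - x‖ := lt_min (half_pos hr) (norm_pos_iff.2 (sub_ne_zero.2 hyx))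
  have h2 := hx.and_eventually (Metric.ball_mem_nhds x hpos)
  obtain ⟨z, ⟨hzx, hzs⟩, hz⟩ := h2.exists
  rw [dist_eq_norm] at hy hz
  have hzy : z = y := by
    apply hs z hzs y hys
    have := norm_sub_le (z - x) (y - x)
    simp only [sub_sub_sub_cancel_right] at this
    have := min_le_left (r / 2) ‖y - x‖
    linarith
  subst hzy
  exact absurd hz (not_lt.2 (min_le_right _ _))

theorem Generated.finite_ballPatch [Finite ι] {P : Set (Tile d M)} (hP : Φ.Generated P)
    (hP' : IsPatch P) (R : ℝ) : (ballPatch R P).Finite := by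
  obtain ⟨r, hr, hsep⟩ := Φ.exists_separation
  obtain ⟨D, hD, hDb⟩ := Φ.exists_norm_bound
  have hfin : ∀ i, {v | (Φ.proto i).translate v ∈ P ∧ ‖v‖ ≤ R + D}.Finite := fun i =>
    finite_of_separated hr (fun x hx => hx.2) fun x hx y hy h => hsep P hP' i x y hx.1 hy.1 h
  refine (Set.finite_iUnion fun i => (hfin i).image fun v => (Φ.proto i).translate v).subset ?_
  rintro τ ⟨hτ, x, hxR, hx⟩
  obtain ⟨i, v, rfl⟩ := hP τ hτ
  rw [Tile.mem_support_translate] at hx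
  refine Set.mem_iUnion.2 ⟨i, v, ⟨hτ, ?_⟩, rfl⟩
  have h1 := hDb i _ hx
  have h2 : ‖x‖ < R := by simpa using hxR
  have := norm_sub_le x (x - v)
  simp only [sub_sub_cancel] at this
  linarith

theorem Generated.finite_of_bounded [Finite ι] {P : Set (Tile d M)} (hP : Φ.Generated P)
    (hP' : IsPatch P) {R : ℝ} (h : ∀ x ∈ supp P, ‖x‖ ≤ R) : P.Finite := by
  refine (hP.finite_ballPatch hP' (R + 1)).subset fun τ hτ => ?_
  obtain ⟨x, hx⟩ := hP.nonempty hτ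
  have := h x (Set.mem_iUnion₂.2 ⟨τ, hτ, hx⟩)
  exact mem_ballPatch hτ hx (by linarith)

theorem finite_subst [Finite ι] (i : ι) : (Φ.subst i).Finite := by
  have hg : Φ.Generated (Φ.subst i) := Φ.subst_proto i
  obtain ⟨C, hC⟩ := ((Φ.proto_compact i).image (continuous_const_smul Φ.ratio)).isBounded.exists_norm_le
  exact hg.finite_of_bounded (Φ.subst_patch i) (R := C) fun x hx => hC x (Φ.subst_supp i ▸ hx)

/-! ### The action of the substitution -/

theorem generated_app (P : Set (Tile d M)) : Φ.Generated (Φ.app P) := by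
  rintro σ ⟨i, v, -, hσ⟩
  exact Generated.translate (Φ.subst_proto i) _ σ hσ

theorem app_mono {P Q : Set (Tile d M)} (h : P ⊆ Q) : Φ.app P ⊆ Φ.app Q := by
  rintro σ ⟨i, v, hv, hσ⟩
  exact ⟨i, v, h hv, hσ⟩

theorem app_translate (P : Set (Tile d M)) (w : Space d) :
    Φ.app (translate P w) = translate (Φ.app P) (Φ.ratio • w) := by
  ext σ
  constructor
  · rintro ⟨i, v, hv, hσ⟩
    rw [mem_translate]
    refine ⟨i, v - w, ?_, ?_⟩
    · rw [mem_translate] at hv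
      simpa [sub_eq_add_neg] using hv
    · rw [mem_translate] at hσ ⊢
      simp only [Tile.translate_translate]
      convert hσ using 2
      rw [smul_sub]; abel
  · intro h
    rw [mem_translate] at h
    obtain ⟨i, v, hv, hσ⟩ := h
    refine ⟨i, v + w, ?_, ?_⟩
    · rw [mem_translate]
      simpa using hv
    · rw [mem_translate] at hσ ⊢
      simp only [Tile.translate_translate] at hσ
      convert hσ using 2
      rw [smul_add]; abel

theorem iterate_app_translate (P : Set (Tile d M)) (w : Space d) (n : ℕ) :
    Φ.app^[n] (translate P w) = translate (Φ.app^[n] P) (Φ.ratio ^ n • w) := by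
  induction n with
  | zero => simp
  | succ n ih => rw [Function.iterate_succ_apply', Function.iterate_succ_apply', ih, app_translate,
      smul_smul, pow_succ']

theorem iterate_app_mono {P Q : Set (Tile d M)} (h : P ⊆ Q) (n : ℕ) : Φ.app^[n] P ⊆ Φ.app^[n] Q := by
  induction n with
  | zero => simpa using h
  | succ n ih => simpa only [Function.iterate_succ_apply'] using app_mono ih

theorem Generated.iterate_app {P : Set (Tile d M)} (hP : Φ.Generated P) (n : ℕ) :
    Φ.Generated (Φ.app^[n] P) := by
  cases n with
  | zero => simpa using hP
  | succ n => rw [Function.iterate_succ_apply']; exact generated_app _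

theorem supp_subst_translate {i : ι} {v : Space d} {σ : Tile d M}
    (hσ : σ ∈ translate (Φ.subst i) (Φ.ratio • v)) {x : Space d} (hx : x ∈ σ.support) :
    Φ.ratio⁻¹ • x ∈ ((Φ.proto i).translate v).support := by
  rw [mem_translate] at hσ
  have h1 : x - Φ.ratio • v ∈ supp (Φ.subst i) := by
    refine Set.mem_iUnion₂.2 ⟨_, hσ, ?_⟩
    rw [Tile.mem_support_translate]
    simpa using hx
  rw [Φ.subst_supp i] at h1
  obtain ⟨y, hy, hyx⟩ := h1
  rw [Tile.mem_support_translate]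
  convert hy using 1
  have : x = Φ.ratio • (y + v) := by
    simp only at hyx
    rw [smul_add, hyx]; abel
  rw [this, inv_smul_smul₀ Φ.ratio_pos.ne']
  abel

/-- Tiles of `Φ(T)` through `ratio • x` come only from tiles of `T` through `x`, because the image
of a tile fills exactly the inflated tile. -/
theorem agreeAt_app {T T' : Set (Tile d M)} {x : Space d} (h : AgreeAt T T' x) :
    AgreeAt (Φ.app T) (Φ.app T') (Φ.ratio • x) := by
  intro σ hσ
  have key : ∀ i v, σ ∈ translate (Φ.subst i) (Φ.ratio • v) →
      x ∈ ((Φ.proto i).translate v).support := by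
    intro i v h
    have := supp_subst_translate h hσ
    rwa [inv_smul_smul₀ Φ.ratio_pos.ne'] at this
  constructor
  · rintro ⟨i, v, hv, h'⟩
    exact ⟨i, v, (h _ (key i v h')).1 hv, h'⟩
  · rintro ⟨i, v, hv, h'⟩
    exact ⟨i, v, (h _ (key i v h')).2 hv, h'⟩

theorem agreeAt_iterate_app {T T' : Set (Tile d M)} {x : Space d} (h : AgreeAt T T' x) (n : ℕ) :
    AgreeAt (Φ.app^[n] T) (Φ.app^[n] T') (Φ.ratio ^ n • x) := by
  induction n with
  | zero => simpa using h
  | succ n ih =>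
    rw [Function.iterate_succ_apply', Function.iterate_succ_apply', pow_succ', ← smul_smul]
    exact agreeAt_app ih

theorem agreeAt_iterate_app_of_le {T T' : Set (Tile d M)} {x : Space d} {m n : ℕ} (hmn : m ≤ n)
    (h : AgreeAt (Φ.app^[m] T) (Φ.app^[m] T') (Φ.ratio ^ m • x)) :
    AgreeAt (Φ.app^[n] T) (Φ.app^[n] T') (Φ.ratio ^ n • x) := by
  obtain ⟨k, rfl⟩ := Nat.exists_eq_add_of_le' hmn
  rw [Function.iterate_add_apply, Function.iterate_add_apply, pow_add, ← smul_smul]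
  exact agreeAt_iterate_app h k

theorem isPatch_app {P : Set (Tile d M)} (hP : IsPatch P) : IsPatch (Φ.app P) := by
  rintro σ ⟨i, v, hv, hσ⟩ τ ⟨j, w, hw, hτ⟩ hne
  by_cases h : (Φ.proto i).translate v = (Φ.proto j).translate w
  · obtain ⟨rfl, rfl⟩ := Φ.proto_translate_injective h
    exact (Φ.subst_patch i).translate _ hσ hτ hne
  · have hd := Set.disjoint_left.1 (hP hv hw h)
    refine Set.disjoint_left.2 ?_
    have key : ∀ i v σ, σ ∈ translate (Φ.subst i) (Φ.ratio • v) → ∀ x ∈ interior σ.support,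
        Φ.ratio⁻¹ • x ∈ interior ((Φ.proto i).translate v).support := by
      intro i v σ hσ x hx
      rw [mem_interior] at hx ⊢
      obtain ⟨t, ht, hto, hxt⟩ := hx
      refine ⟨(fun y => Φ.ratio⁻¹ • y) '' t, ?_, ?_, ⟨x, hxt, rfl⟩⟩
      · rintro _ ⟨y, hy, rfl⟩
        exact supp_subst_translate hσ (ht hy)
      · exact (isOpenMap_smul₀ (inv_ne_zero Φ.ratio_pos.ne')) t hto
    intro x hx hx'
    exact hd (key i v σ hσ x hx) (key j w τ hτ x hx')

theorem isTiling_app {T : Set (Tile d M)} (hT : IsTiling T) (hg : Φ.Generated T) :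
    IsTiling (Φ.app T) := by
  refine ⟨isPatch_app hT.1, Set.eq_univ_of_forall fun x => ?_⟩
  obtain ⟨τ, hτ, hx⟩ := hT.exists_mem (Φ.ratio⁻¹ • x)
  obtain ⟨i, v, rfl⟩ := hg τ hτ
  rw [Tile.mem_support_translate] at hx
  have h1 : x - Φ.ratio • v ∈ supp (Φ.subst i) := by
    rw [Φ.subst_supp i]
    refine ⟨_, hx, ?_⟩
    simp only
    rw [smul_sub, smul_inv_smul₀ Φ.ratio_pos.ne']
  obtain ⟨σ, hσ, hxσ⟩ := Set.mem_iUnion₂.1 h1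
  refine Set.mem_iUnion₂.2 ⟨σ.translate (Φ.ratio • v), ⟨i, v, hτ, σ, hσ, rfl⟩, ?_⟩
  rwa [Tile.mem_support_translate]

theorem app_eq_iUnion (P : Set (Tile d M)) : Φ.app P = ⋃ τ ∈ P, Φ.app {τ} := by
  ext σ
  constructor
  · rintro ⟨i, v, hv, hσ⟩
    exact Set.mem_iUnion₂.2 ⟨_, hv, i, v, rfl, hσ⟩
  · intro h
    obtain ⟨τ, hτ, i, v, hv, hσ⟩ := Set.mem_iUnion₂.1 h
    exact ⟨i, v, by rw [Set.mem_singleton_iff.1 hv]; exact hτ, hσ⟩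

end SelfSimilarSubstitution

namespace SelfSimilarSubstitution

open SubstTiling

variable {d : ℕ} {M ι : Type*} {Φ : SelfSimilarSubstitution d M ι}

/-! ### The tiling space -/

theorem Allowed.mono {P Q : Set (Tile d M)} (hQ : Φ.Allowed Q) (h : P ⊆ Q) : Φ.Allowed P := by
  obtain ⟨m, hm, i, v, hv⟩ := hQ
  exact ⟨m, hm, i, v, h.trans hv⟩

theorem Allowed.translate {P : Set (Tile d M)} (hP : Φ.Allowed P) (w : Space d) :
    Φ.Allowed (translate P w) := by
  obtain ⟨m, hm, i, v, hv⟩ := hP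
  refine ⟨m, hm, i, v - w, (translate_mono hv w).trans_eq ?_⟩
  simp [shift_eq, sub_eq_add_neg, add_comm]

theorem Allowed.app {P : Set (Tile d M)} (hP : Φ.Allowed P) : Φ.Allowed (Φ.app P) := by
  obtain ⟨m, hm, i, v, hv⟩ := hP
  refine ⟨m + 1, by omega, i, Φ.ratio • v, (app_mono hv).trans_eq ?_⟩
  rw [shift_eq, app_translate, Function.iterate_succ_apply', shift_eq, smul_neg]

theorem Allowed.generated {P : Set (Tile d M)} (hP : Φ.Allowed P) : Φ.Generated P := by
  obtain ⟨m, -, i, v, hv⟩ := hP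
  exact Generated.mono ((generated_proto i).iterate_app m |>.translate _) hv

theorem generated_of_mem {T : Set (Tile d M)} (hT : T ∈ Φ.tilingSpace) : Φ.Generated T :=
  fun τ hτ => (hT.2 {τ} (by simpa using hτ) (Set.finite_singleton τ)).generated τ rfl

theorem translate_mem {T : Set (Tile d M)} (hT : T ∈ Φ.tilingSpace) (v : Space d) :
    translate T v ∈ Φ.tilingSpace := by
  refine ⟨hT.1.translate v, fun P hP hfin => ?_⟩
  have h1 : translate P (-v) ⊆ T := by simpa using translate_mono hP (-v)
  simpa using (hT.2 _ h1 (hfin.image _)).translate v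

theorem shift_mem {T : Set (Tile d M)} (hT : T ∈ Φ.tilingSpace) (v : Space d) :
    shift T v ∈ Φ.tilingSpace := translate_mem hT _

theorem exists_finite_of_subset_app {T P : Set (Tile d M)} (hP : P.Finite) (h : P ⊆ Φ.app T) :
    ∃ Q ⊆ T, Q.Finite ∧ P ⊆ Φ.app Q := by
  have h1 : ∀ σ ∈ P, ∃ τ ∈ T, σ ∈ Φ.app {τ} := by
    intro σ hσ
    have := h hσ
    rw [app_eq_iUnion] at this
    simpa using this
  choose! f hf hf' using h1
  refine ⟨f '' P, Set.image_subset_iff.2 hf, hP.image f, fun σ hσ => ?_⟩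
  exact app_mono (Set.singleton_subset_iff.2 (Set.mem_image_of_mem f hσ)) (hf' σ hσ)

theorem app_mem {T : Set (Tile d M)} (hT : T ∈ Φ.tilingSpace) : Φ.app T ∈ Φ.tilingSpace := by
  refine ⟨isTiling_app hT.1 (generated_of_mem hT), fun P hP hfin => ?_⟩
  obtain ⟨Q, hQT, hQ, hPQ⟩ := exists_finite_of_subset_app hfin hP
  exact (hT.2 Q hQT hQ).app.mono hPQ

theorem iterate_app_mem {T : Set (Tile d M)} (hT : T ∈ Φ.tilingSpace) (n : ℕ) :
    Φ.app^[n] T ∈ Φ.tilingSpace := by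
  induction n with
  | zero => simpa using hT
  | succ n ih => rw [Function.iterate_succ_apply']; exact app_mem ih

theorem eq_of_agreeAt_of_mem {T T' : Set (Tile d M)} (hT : T ∈ Φ.tilingSpace)
    (hT' : T' ∈ Φ.tilingSpace) (h : ∀ x, AgreeAt T T' x) : T = T' :=
  eq_of_agreeAt (fun _ hτ => (generated_of_mem hT).nonempty hτ)
    (fun _ hτ => (generated_of_mem hT').nonempty hτ) h

theorem finite_ballPatch [Finite ι] {T : Set (Tile d M)} (hT : T ∈ Φ.tilingSpace) (R : ℝ) :
    (ballPatch R T).Finite :=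
  (generated_of_mem hT).finite_ballPatch hT.1.1 R

/-- Agreement of tilings at a point is an open condition. -/
theorem eventually_agreeAt [Finite ι] {T T' : Set (Tile d M)} (hT : T ∈ Φ.tilingSpace)
    (hT' : T' ∈ Φ.tilingSpace) {x : Space d} (h : AgreeAt T T' x) :
    ∀ᶠ y in 𝓝 x, AgreeAt T T' y := by
  have hfin := (finite_ballPatch hT (‖x‖ + 1)).union (finite_ballPatch hT' (‖x‖ + 1))
  -- Only finitely many closed tiles are relevant, and those missing `x` stay away from it; hence no
  -- new tile appears at nearby points.
  have h1 : ∀ᶠ y in 𝓝 x, ∀ τ ∈ ballPatch (‖x‖ + 1) T ∪ ballPatch (‖x‖ + 1) T',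
      y ∈ τ.support → x ∈ τ.support := by
    rw [eventually_all_finite hfin]
    intro τ hτ
    have hcl : IsClosed τ.support := by
      rcases hτ with hτ | hτ
      · exact ((generated_of_mem hT).isCompact hτ.1).isClosed
      · exact ((generated_of_mem hT').isCompact hτ.1).isClosed
    by_cases hx : x ∈ τ.support
    · exact Eventually.of_forall fun _ _ => hx
    · filter_upwards [hcl.isOpen_compl.mem_nhds hx] with y hy hy'
      exact absurd hy' hy
  have h2 : ∀ᶠ y in 𝓝 x, ‖y‖ < ‖x‖ + 1 :=
    continuous_norm.continuousAt.eventually (gt_mem_nhds (by simp))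
  filter_upwards [h1, h2] with y hy hyn τ hτ
  constructor
  · intro hτT
    exact (h τ (hy τ (Or.inl (mem_ballPatch hτT hτ hyn)) hτ)).1 hτT
  · intro hτT
    exact (h τ (hy τ (Or.inr (mem_ballPatch hτT hτ hyn)) hτ)).2 hτT

/-! ### Compactness -/

theorem exists_ballPatch_types [Finite ι] (hflc : HasFLC Φ.tilingSpace) (R : ℝ) :
    ∃ F : Set (Set (Tile d M)), F.Finite ∧ ∀ T ∈ Φ.tilingSpace, ∃ Q ∈ F, ∃ v : Space d,
      ballPatch R T = translate Q v := by
  obtain ⟨D, hD, hDb⟩ := Φ.exists_diam_bound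
  obtain ⟨F, hF, hFT⟩ := hflc (2 * (R + D))
  refine ⟨F, hF, fun T hT => hFT _ hT _ (ballPatch_subset _ _) ?_⟩
  have hsupp : ∀ x ∈ supp (ballPatch R T), ‖x‖ ≤ R + D := by
    intro x hx
    obtain ⟨τ, ⟨hτT, y, hyR, hyτ⟩, hxτ⟩ := Set.mem_iUnion₂.1 hx
    have h1 := hDb _ (generated_of_mem hT) τ hτT x hxτ y hyτ
    have h2 : ‖y‖ < R := by simpa using hyR
    have := norm_add_le (x - y) y
    simp only [sub_add_cancel] at this
    linarith
  intro x hx y hy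
  rw [dist_eq_norm]
  have := norm_sub_le x y
  linarith [hsupp x hx, hsupp y hy]

/-- Among finitely many patch types an ultrafilter selects one. Limits along the fixed non-principal
ultrafilter stand in for passing to subsequences throughout. -/
theorem exists_eventually_ballPatch_eq [Finite ι] (hflc : HasFLC Φ.tilingSpace)
    {S : ℕ → Set (Tile d M)} (hS : ∀ n, S n ∈ Φ.tilingSpace) (R : ℝ) :
    ∃ n₀, ∃ b : ℕ → Space d, ∀ᶠ n in (hyperfilter ℕ : Filter ℕ),
      ballPatch R (S n) = translate (ballPatch R (S n₀)) (b n) := by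
  obtain ⟨F, hF, hFT⟩ := exists_ballPatch_types hflc R
  obtain ⟨Q, -, hQ⟩ := (Ultrafilter.eventually_exists_mem_iff hF).1
    (Eventually.of_forall fun n => hFT _ (hS n) :
      ∀ᶠ n in (hyperfilter ℕ : Filter ℕ), _)
  obtain ⟨n₀, v₀, hv₀⟩ := hQ.exists
  choose! b hb using fun (n : ℕ) (h : ∃ v, ballPatch R (S n) = translate Q v) => h
  refine ⟨n₀, fun n => b n - v₀, ?_⟩
  filter_upwards [hQ] with n hn
  rw [hb n hn, hv₀]
  simp

/-- Membership in the tiling space is tested on finitely many tiles, or at one point, at a time, so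
it is inherited by local limits. -/
theorem mem_tilingSpace_of_limit {l : Filter ℕ} [l.NeBot] {S : ℕ → Set (Tile d M)}
    (hS : ∀ n, S n ∈ Φ.tilingSpace) {T : Set (Tile d M)} (hT : ∀ τ ∈ T, ∀ᶠ n in l, τ ∈ S n)
    (h : ∀ R, ∀ᶠ n in l, ∀ x, ‖x‖ < R → AgreeAt (S n) T x) : T ∈ Φ.tilingSpace := by
  refine ⟨⟨fun σ hσ τ hτ hne => ?_, Set.eq_univ_of_forall fun x => ?_⟩, fun P hP hfin => ?_⟩
  · obtain ⟨n, h1, h2⟩ := ((hT σ hσ).and (hT τ hτ)).exists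
    exact (hS n).1.1 h1 h2 hne
  · obtain ⟨n, hn⟩ := (h (‖x‖ + 1)).exists
    obtain ⟨τ, hτ, hx⟩ := (hS n).1.exists_mem x
    exact Set.mem_iUnion₂.2 ⟨τ, (hn x (by linarith) τ hx).1 hτ, hx⟩
  · obtain ⟨n, hn⟩ := ((eventually_all_finite hfin).2 fun τ hτ => hT τ (hP hτ)).exists
    exact (hS n).2 P hn hfin

/-- A sequence of tilings each of which contains, near the origin, a tile from a fixed finite set,
converges, along an ultrafilter, to a tiling. -/
theorem exists_limit [Finite ι] (hflc : HasFLC Φ.tilingSpace)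
    {S : ℕ → Set (Tile d M)} (hS : ∀ n, S n ∈ Φ.tilingSpace) {E : Set (Tile d M)} (hE : E.Finite)
    {R₀ : ℝ} (hpin : ∀ᶠ n in (hyperfilter ℕ : Filter ℕ), ∃ τ ∈ E, τ ∈ ballPatch R₀ (S n)) :
    ∃ T ∈ Φ.tilingSpace, ∀ R, ∀ᶠ n in (hyperfilter ℕ : Filter ℕ),
      ∀ x, ‖x‖ < R → AgreeAt (S n) T x := by
  obtain ⟨τ, -, hτ⟩ := (Ultrafilter.eventually_exists_mem_iff hE).1 hpin
  have key : ∀ R, R₀ ≤ R → ∃ C : Set (Tile d M), ∀ᶠ n in (hyperfilter ℕ : Filter ℕ),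
      ballPatch R (S n) = C := by
    intro R hR
    obtain ⟨n₀, b, hb⟩ := exists_eventually_ballPatch_eq hflc hS R
    -- The common tile `τ` pins the translation: `τ - b n` lies in a fixed finite set, hence is
    -- constant along the ultrafilter, and so is `b n` since `τ` has no translational period.
    have h1 : ∀ᶠ n in (hyperfilter ℕ : Filter ℕ), ∃ σ ∈ ballPatch R (S n₀),
        τ.translate (-b n) = σ := by
      filter_upwards [hb, hτ] with n hn hτn
      have : τ ∈ ballPatch R (S n) :=
        ⟨hτn.1, hτn.2.mono (Set.inter_subset_inter_left _ (Metric.ball_subset_ball hR))⟩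
      rw [hn, mem_translate] at this
      exact ⟨_, this, rfl⟩
    obtain ⟨σ, -, hσ⟩ := (Ultrafilter.eventually_exists_mem_iff (finite_ballPatch (hS n₀) R)).1 h1
    obtain ⟨n₁, hn₁, hτ₁⟩ := (hσ.and hτ).exists
    refine ⟨translate (ballPatch R (S n₀)) (b n₁), ?_⟩
    filter_upwards [hb, hσ] with n hn hσn
    have := (generated_of_mem (hS n₁)).translate_injective hτ₁.1 (hσn.trans hn₁.symm)
    rw [hn, neg_injective this]
  have hag : ∀ R, ∀ᶠ n in (hyperfilter ℕ : Filter ℕ), ∀ x, ‖x‖ < R →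
      AgreeAt (S n) {τ | ∀ᶠ n in (hyperfilter ℕ : Filter ℕ), τ ∈ S n} x := by
    intro R
    obtain ⟨C, hC⟩ := key (max R R₀) (le_max_right _ _)
    filter_upwards [hC] with n hn x hx τ hτ
    have hx' := hx.trans_le (le_max_left R R₀)
    constructor
    · intro h
      have h1 := mem_ballPatch h hτ hx'
      rw [hn] at h1
      change ∀ᶠ n in (hyperfilter ℕ : Filter ℕ), τ ∈ S n
      filter_upwards [hC] with m hm
      rw [← hm] at h1
      exact h1.1
    · intro h
      obtain ⟨m, hm, hτm⟩ := (hC.and h).exists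
      have h1 := mem_ballPatch hτm hτ hx'
      rw [hm, ← hn] at h1
      exact h1.1
  exact ⟨_, mem_tilingSpace_of_limit hS (fun τ hτ => hτ) hag, hag⟩

/-! ### Occurrence of prototiles and surjectivity of the substitution -/

theorem IsPrimitive.exists_translate_subset (hprim : Φ.IsPrimitive) {T : Set (Tile d M)}
    (hT : T ∈ Φ.tilingSpace) (i : ι) :
    ∃ (n : ℕ) (v : Space d), translate {Φ.proto i} v ⊆ Φ.app^[n] T := by
  obtain ⟨τ, hτ, -⟩ := hT.1.exists_mem 0
  obtain ⟨j, w, rfl⟩ := generated_of_mem hT τ hτ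
  obtain ⟨n, v, hv⟩ := hprim i j
  refine ⟨n, v + Φ.ratio ^ n • w, ?_⟩
  have h1 : translate {Φ.proto j} w ⊆ T := by
    rintro _ ⟨τ, rfl, rfl⟩
    exact hτ
  have h2 := iterate_app_mono (Φ := Φ) h1 n
  rw [iterate_app_translate] at h2
  refine Set.Subset.trans ?_ h2
  rintro _ ⟨τ, rfl, rfl⟩
  exact ⟨_, hv, by simp⟩

/-- `P` lies in a supertile of some order `m + 1 ≥ 1`, and its prototile occurs in some `Φ^n(T)`.
Applying `Φ^m` there, with a suitable translation, leaves exactly one substitution to reach `P`;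
this is where the order being at least `1` matters. -/
theorem IsPrimitive.exists_app_superset (hprim : Φ.IsPrimitive) {T : Set (Tile d M)}
    (hT : T ∈ Φ.tilingSpace) {P : Set (Tile d M)} (hP : P ⊆ T) (hfin : P.Finite) :
    ∃ S ∈ Φ.tilingSpace, P ⊆ Φ.app S := by
  obtain ⟨m, hm, i, v, hv⟩ := hT.2 P hP hfin
  obtain ⟨n, w, hw⟩ := hprim.exists_translate_subset hT i
  obtain ⟨m, rfl⟩ := Nat.exists_eq_add_of_le' hm
  refine ⟨translate (Φ.app^[m] (translate (Φ.app^[n] T) (-w))) (-(Φ.ratio⁻¹ • v)),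
    translate_mem (iterate_app_mem (translate_mem (iterate_app_mem hT n) _) m) _, ?_⟩
  refine hv.trans ?_
  rw [app_translate, ← Function.iterate_succ_apply' Φ.app, shift_eq, smul_neg,
    smul_inv_smul₀ Φ.ratio_pos.ne']
  refine translate_mono (iterate_app_mono ?_ _) _
  simpa using translate_mono hw (-w)

/-- Surjectivity by compactness: tilings whose images contain larger and larger ball patches of `T`
have a limit, and its image is `T`. -/
theorem exists_app_eq [Finite ι] (hprim : Φ.IsPrimitive) (hflc : HasFLC Φ.tilingSpace)
    {T : Set (Tile d M)} (hT : T ∈ Φ.tilingSpace) : ∃ S ∈ Φ.tilingSpace, Φ.app S = T := by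
  choose S hS hTS using fun n : ℕ => hprim.exists_app_superset hT (ballPatch_subset n T)
    (finite_ballPatch hT n)
  have hag : ∀ (n : ℕ) (x : Space d), ‖x‖ < (n : ℝ) → AgreeAt T (Φ.app (S n)) x := fun n x hx =>
    agreeAt_of_ballPatch_subset hT.1 (generated_of_mem hT) (app_mem (hS n)).1.1
      (generated_app _) (hTS n) hx
  -- The possible parents of tiles of `T` near the origin. There are finitely many, because a parent
  -- is determined by its type and one of its children; they pin the approximate preimages.
  let E : Set (Tile d M) := ⋃ i, ⋃ σ ∈ Φ.subst i, ⋃ σ' ∈ ballPatch 1 T,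
    {τ | ∃ v, τ = (Φ.proto i).translate v ∧ σ.translate (Φ.ratio • v) = σ'}
  have hE : E.Finite := by
    refine Set.finite_iUnion fun i => (finite_subst i).biUnion fun σ hσ =>
      (finite_ballPatch hT 1).biUnion fun σ' _ => Set.Subsingleton.finite ?_
    rintro _ ⟨v, rfl, hv⟩ _ ⟨w, rfl, hw⟩
    have hg : Φ.Generated (Φ.subst i) := Φ.subst_proto i
    have := hg.translate_injective hσ (hv.trans hw.symm)
    rw [smul_right_injective _ Φ.ratio_pos.ne' this]
  have hpin : ∀ᶠ n in (hyperfilter ℕ : Filter ℕ), ∃ τ ∈ E, τ ∈ ballPatch 1 (S n) := by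
    have h1 : ∀ᶠ n : ℕ in (hyperfilter ℕ : Filter ℕ), 1 ≤ n :=
      (eventually_ge_atTop 1).filter_mono Nat.hyperfilter_le_atTop
    filter_upwards [h1] with n hn
    obtain ⟨σ', hσ', h0⟩ := (app_mem (hS n)).1.exists_mem 0
    have hσT : σ' ∈ T := (hag n 0 (by simp; omega) σ' h0).2 hσ'
    obtain ⟨i, v, hv, hσ''⟩ := hσ'
    have h0' := supp_subst_translate hσ'' h0
    rw [smul_zero] at h0'
    obtain ⟨σ, hσ, hσσ'⟩ := hσ''
    refine ⟨(Φ.proto i).translate v, ?_, mem_ballPatch hv h0' (by simp)⟩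
    simp only [E, Set.mem_iUnion]
    exact ⟨i, σ, hσ, σ', mem_ballPatch hσT h0 (by simp), v, rfl, hσσ'⟩
  obtain ⟨S', hS', hlim⟩ := exists_limit hflc hS hE hpin
  refine ⟨S', hS', eq_of_agreeAt_of_mem (app_mem hS') hT fun x => ?_⟩
  have h1 : ∀ᶠ n : ℕ in (hyperfilter ℕ : Filter ℕ), ‖x‖ < (n : ℝ) :=
    (tendsto_natCast_atTop_atTop.eventually_gt_atTop ‖x‖).filter_mono Nat.hyperfilter_le_atTop
  obtain ⟨n, hn, hn'⟩ := (h1.and (hlim (‖Φ.ratio⁻¹ • x‖ + 1))).exists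
  have h2 := agreeAt_app (Φ := Φ) (hn' (Φ.ratio⁻¹ • x) (by linarith))
  rw [smul_inv_smul₀ Φ.ratio_pos.ne'] at h2
  exact h2.symm.trans (hag n x hn).symm

theorem exists_iterate_app_eq [Finite ι] (hprim : Φ.IsPrimitive) (hflc : HasFLC Φ.tilingSpace)
    {T : Set (Tile d M)} (hT : T ∈ Φ.tilingSpace) :
    ∃ S : ℕ → Set (Tile d M), (∀ n, S n ∈ Φ.tilingSpace) ∧ S 0 = T ∧
      ∀ n, Φ.app (S (n + 1)) = S n := by
  choose! g hg hg' using fun (T : Set (Tile d M)) (hT : T ∈ Φ.tilingSpace) =>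
    exists_app_eq hprim hflc hT
  have h : ∀ n, g^[n] T ∈ Φ.tilingSpace := by
    intro n
    induction n with
    | zero => simpa using hT
    | succ n ih => rw [Function.iterate_succ_apply']; exact hg _ ih
  exact ⟨fun n => g^[n] T, h, rfl, fun n => by
    simp only [Function.iterate_succ_apply']; exact hg' _ (h n)⟩

end SelfSimilarSubstitution

/-! ### Eventual agreement. -/

namespace SelfSimilarSubstitution

open SubstTiling

variable {d : ℕ} {M ι : Type*} (Φ : SelfSimilarSubstitution d M ι)

/-- Some power of the substitution makes `T` and `T'` agree at (the image of) the point `x`. -/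
def EventuallyAgree (T T' : Set (Tile d M)) (x : Space d) : Prop :=
  ∃ n : ℕ, AgreeAt (Φ.app^[n] T) (Φ.app^[n] T') (Φ.ratio ^ n • x)

variable {Φ}

theorem eventuallyAgree_translate {T T' : Set (Tile d M)} {v x : Space d} :
    Φ.EventuallyAgree (translate T v) (translate T' v) x ↔ Φ.EventuallyAgree T T' (x - v) := by
  refine exists_congr fun n => ?_
  rw [iterate_app_translate, iterate_app_translate, agreeAt_translate, smul_sub]

theorem eventuallyAgree_shift {T T' : Set (Tile d M)} {v x : Space d} :
    Φ.EventuallyAgree (shift T v) (shift T' v) x ↔ Φ.EventuallyAgree T T' (x + v) := by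
  rw [shift_eq, shift_eq, eventuallyAgree_translate, sub_neg_eq_add]

theorem eventuallyAgree_iterate_app {T T' : Set (Tile d M)} {x : Space d} (k : ℕ) :
    Φ.EventuallyAgree (Φ.app^[k] T) (Φ.app^[k] T') (Φ.ratio ^ k • x) ↔
      Φ.EventuallyAgree T T' x := by
  constructor
  · rintro ⟨n, hn⟩
    refine ⟨n + k, ?_⟩
    rwa [Function.iterate_add_apply, Function.iterate_add_apply, pow_add, ← smul_smul]
  · rintro ⟨n, hn⟩
    refine ⟨n, ?_⟩
    have := agreeAt_iterate_app_of_le (Nat.le_add_right n k) hn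
    rwa [Function.iterate_add_apply, Function.iterate_add_apply, pow_add, ← smul_smul] at this

/-- Eventual agreement at `x` sees only the tiles at `x`; this transfers it between pairs that look
alike locally. -/
theorem eventuallyAgree_congr {S S' T T' : Set (Tile d M)} {x : Space d} (h : AgreeAt S T x)
    (h' : AgreeAt S' T' x) : Φ.EventuallyAgree S S' x ↔ Φ.EventuallyAgree T T' x := by
  refine exists_congr fun n => ?_
  have h1 := agreeAt_iterate_app (Φ := Φ) h n
  have h2 := agreeAt_iterate_app (Φ := Φ) h' n
  exact ⟨fun h => (h1.symm.trans h).trans h2, fun h => (h1.trans h).trans h2.symm⟩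

theorem isOpen_agreeAt_iterate [Finite ι] {T T' : Set (Tile d M)} (hT : T ∈ Φ.tilingSpace)
    (hT' : T' ∈ Φ.tilingSpace) (n : ℕ) :
    IsOpen {x | AgreeAt (Φ.app^[n] T) (Φ.app^[n] T') (Φ.ratio ^ n • x)} := by
  rw [isOpen_iff_eventually]
  intro x hx
  exact (continuous_const_smul (Φ.ratio ^ n)).continuousAt.eventually
    (eventually_agreeAt (iterate_app_mem hT n) (iterate_app_mem hT' n) hx)

theorem isOpen_eventuallyAgree [Finite ι] {T T' : Set (Tile d M)} (hT : T ∈ Φ.tilingSpace)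
    (hT' : T' ∈ Φ.tilingSpace) : IsOpen {x | Φ.EventuallyAgree T T' x} := by
  have : {x | Φ.EventuallyAgree T T' x} =
      ⋃ n : ℕ, {x | AgreeAt (Φ.app^[n] T) (Φ.app^[n] T') (Φ.ratio ^ n • x)} := by
    ext x; simp [EventuallyAgree]
  rw [this]
  exact isOpen_iUnion fun n => isOpen_agreeAt_iterate hT hT' n

theorem exists_agreeAt_of_isCompact [Finite ι] {T T' : Set (Tile d M)} (hT : T ∈ Φ.tilingSpace)
    (hT' : T' ∈ Φ.tilingSpace) {K : Set (Space d)} (hK : IsCompact K)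
    (h : ∀ x ∈ K, Φ.EventuallyAgree T T' x) :
    ∃ n : ℕ, ∀ x ∈ K, AgreeAt (Φ.app^[n] T) (Φ.app^[n] T') (Φ.ratio ^ n • x) := by
  obtain ⟨n, hn⟩ := hK.elim_directed_cover
    (fun n : ℕ => {x | AgreeAt (Φ.app^[n] T) (Φ.app^[n] T') (Φ.ratio ^ n • x)})
    (isOpen_agreeAt_iterate hT hT') (fun x hx => Set.mem_iUnion.2 (h x hx))
    (Monotone.directed_le fun m n hmn x hx => agreeAt_iterate_app_of_le hmn hx)
  exact ⟨n, fun x hx => hn hx⟩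

/-! ### Stable equivalence -/

theorem tilingDist_nonneg (T T' : Set (Tile d M)) : 0 ≤ tilingDist T T' := by
  refine Real.sInf_nonneg fun ε hε => ?_
  rcases hε with rfl | hε
  · exact zero_le_one
  · exact hε.1.le

theorem tilingDist_le {T T' : Set (Tile d M)} {ε : ℝ} (hε : 0 < ε) (h : Close ε T T') :
    tilingDist T T' ≤ ε := by
  refine csInf_le ⟨0, ?_⟩ (Or.inr ⟨hε, h⟩)
  rintro δ (rfl | hδ)
  · exact zero_le_one
  · exact hδ.1.le

theorem close_of_agreeAt {T T' : Set (Tile d M)} {R : ℝ} (hR : 0 < R)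
    (h : ∀ x, ‖x‖ < R → AgreeAt T T' x) : Close R⁻¹ T T' := by
  refine ⟨0, 0, by simpa using hR, by simpa using hR, ?_⟩
  rw [ballPatch_eq_iff]
  simpa [shift_eq] using h

theorem exists_close_of_tilingDist_lt {T T' : Set (Tile d M)} {ε : ℝ} (hε : ε ≤ 1)
    (h : tilingDist T T' < ε) : ∃ δ, 0 < δ ∧ δ < ε ∧ Close δ T T' := by
  obtain ⟨δ, hδ, hlt⟩ := exists_lt_of_csInf_lt ⟨1, Set.mem_insert _ _⟩ h
  rcases hδ with rfl | hδ
  · exact absurd hlt (not_lt.2 hε)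
  · exact ⟨δ, hδ.1, hlt, hδ.2⟩

theorem exists_agreeAt_of_close {T T' : Set (Tile d M)} {ε : ℝ} (h : Close ε T T') :
    ∃ w : Space d, ‖w‖ < ε ∧ ∀ x, ‖x‖ < 1 / ε - ε → AgreeAt (translate T w) T' x := by
  obtain ⟨v, v', hv, hv', h⟩ := h
  rw [ballPatch_eq_iff] at h
  refine ⟨v' - v, ?_, fun x hx => ?_⟩
  · linarith [norm_sub_le v' v]
  · have h1 : ‖x - v'‖ < 1 / ε := by
      linarith [norm_sub_le x v', norm_nonneg v']
    have h2 := agreeAt_translate (v := v') |>.2 (h (x - v') h1)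
    simpa [shift_eq, sub_eq_add_neg, add_comm] using h2

/-- Agreement at the origin spreads to a ball by openness, and further substitution inflates that
ball geometrically. -/
theorem stablyEquiv_of_eventuallyAgree [Finite ι] {T T' : Set (Tile d M)} (hT : T ∈ Φ.tilingSpace)
    (hT' : T' ∈ Φ.tilingSpace) (h : Φ.EventuallyAgree T T' 0) : Φ.StablyEquiv T T' := by
  obtain ⟨n, hn⟩ := h
  rw [smul_zero] at hn
  obtain ⟨r, hr, hball⟩ := Metric.eventually_nhds_iff.1
    (eventually_agreeAt (iterate_app_mem hT n) (iterate_app_mem hT' n) hn)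
  have hle : ∀ m : ℕ, tilingDist (Φ.app^[m + n] T) (Φ.app^[m + n] T') ≤ r⁻¹ * (Φ.ratio⁻¹) ^ m := by
    intro m
    have hpos : 0 < Φ.ratio ^ m := pow_pos Φ.ratio_pos m
    have : r⁻¹ * (Φ.ratio⁻¹) ^ m = (Φ.ratio ^ m * r)⁻¹ := by
      rw [mul_inv, inv_pow, mul_comm]
    rw [this]
    refine tilingDist_le (by positivity) (close_of_agreeAt (by positivity) fun x hx => ?_)
    have h1 : dist ((Φ.ratio ^ m)⁻¹ • x) 0 < r := by
      rw [dist_zero_right, norm_smul, norm_inv, Real.norm_of_nonneg hpos.le, inv_mul_lt_iff₀ hpos]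
      exact hx
    have h2 := agreeAt_iterate_app (Φ := Φ) (hball h1) m
    rw [smul_inv_smul₀ hpos.ne'] at h2
    rwa [Function.iterate_add_apply, Function.iterate_add_apply]
  unfold StablyEquiv
  rw [← tendsto_add_atTop_iff_nat n]
  refine squeeze_zero (fun m => tilingDist_nonneg _ _) hle ?_
  have := tendsto_pow_atTop_nhds_zero_of_lt_one (inv_nonneg.2 Φ.ratio_pos.le)
    (inv_lt_one_of_one_lt₀ Φ.one_lt_ratio)
  simpa using this.const_mul r⁻¹

/-- Closeness gives agreement at the origin up to small displacements `w k`. Substituting multiplies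
a displacement by `ratio`, and separation of tiles makes it unique, so `w (k + 1) = ratio • w k`;
staying bounded, all of them vanish. -/
theorem eventuallyAgree_of_stablyEquiv [Finite ι] {T T' : Set (Tile d M)} (hT : T ∈ Φ.tilingSpace)
    (hT' : T' ∈ Φ.tilingSpace) (h : Φ.StablyEquiv T T') : Φ.EventuallyAgree T T' 0 := by
  obtain ⟨r, hr, hsep⟩ := Φ.exists_tile_separation
  have hlam := Φ.ratio_pos
  -- `ε ≤ 1 / 2` keeps the origin inside the region of agreement; `ε * (ratio + 1) ≤ r` puts `w (k +
  -- 1)` and `ratio • w k` within the separation distance.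
  set ε := min (1 / 2) (r / (Φ.ratio + 1)) with hε
  have hεpos : 0 < ε := by positivity
  have hε2 : ε ≤ 1 / 2 := min_le_left _ _
  have hεr : ε * (Φ.ratio + 1) ≤ r := by
    rw [← le_div_iff₀ (by positivity)]
    exact min_le_right _ _
  obtain ⟨N, hN⟩ := eventually_atTop.1 ((tendsto_order.1 h).2 ε hεpos)
  have h1 : ∀ k, ∃ w : Space d, ‖w‖ < ε ∧
      AgreeAt (translate (Φ.app^[k + N] T) w) (Φ.app^[k + N] T') 0 := by
    intro k
    obtain ⟨δ, hδ, hδε, hcl⟩ := exists_close_of_tilingDist_lt (by linarith) (hN (k + N) (by omega))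
    obtain ⟨w, hw, hag⟩ := exists_agreeAt_of_close hcl
    refine ⟨w, hw.trans hδε, hag 0 ?_⟩
    rw [norm_zero, sub_pos, lt_div_iff₀ hδ]
    nlinarith
  choose w hw hag using h1
  have hstep : ∀ k, w (k + 1) = Φ.ratio • w k := by
    intro k
    have h2 := agreeAt_app (Φ := Φ) (hag k)
    rw [smul_zero, app_translate, ← Function.iterate_succ_apply' Φ.app,
      ← Function.iterate_succ_apply' Φ.app] at h2
    have h3 := hag (k + 1)
    rw [show k + 1 + N = (k + N).succ by omega] at h3
    obtain ⟨σ, hσ, h0⟩ := (iterate_app_mem hT' (k + N).succ).1.exists_mem 0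
    have h4 := mem_translate.1 ((h2 σ h0).2 hσ)
    have h5 := mem_translate.1 ((h3 σ h0).2 hσ)
    have hA := iterate_app_mem hT (k + N).succ
    have := hsep _ hA.1.1 (generated_of_mem hA) _ _ _ h4 h5 ?_
    · exact (neg_injective this).symm
    · rw [neg_sub_neg]
      have h6 := norm_sub_le (w (k + 1)) (Φ.ratio • w k)
      rw [norm_smul, Real.norm_of_nonneg hlam.le] at h6
      have := mul_lt_mul_of_pos_left (hw k) hlam
      linarith [hw (k + 1)]
  have hpow : ∀ k, w k = Φ.ratio ^ k • w 0 := by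
    intro k
    induction k with
    | zero => simp
    | succ k ih => rw [hstep, ih, smul_smul, pow_succ']
  have hw0 : w 0 = 0 := by
    by_contra hne
    have hpos : 0 < ‖w 0‖ := norm_pos_iff.2 hne
    obtain ⟨k, hk⟩ := pow_unbounded_of_one_lt (ε / ‖w 0‖) Φ.one_lt_ratio
    rw [div_lt_iff₀ hpos] at hk
    have := hw k
    rw [hpow, norm_smul, norm_pow, Real.norm_of_nonneg hlam.le] at this
    linarith
  refine ⟨N, ?_⟩
  have := hag 0
  rwa [hw0, SubstTiling.translate_zero, zero_add, ← smul_zero (Φ.ratio ^ N)] at this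

theorem stablyEquiv_shift_iff [Finite ι] {T T' : Set (Tile d M)} (hT : T ∈ Φ.tilingSpace)
    (hT' : T' ∈ Φ.tilingSpace) (x : Space d) :
    Φ.StablyEquiv (shift T x) (shift T' x) ↔ Φ.EventuallyAgree T T' x := by
  have h := eventuallyAgree_shift (Φ := Φ) (T := T) (T' := T') (v := x) (x := 0)
  rw [zero_add] at h
  rw [← h]
  exact ⟨eventuallyAgree_of_stablyEquiv (shift_mem hT x) (shift_mem hT' x),
    stablyEquiv_of_eventuallyAgree (shift_mem hT x) (shift_mem hT' x)⟩

theorem stablyEquiv_iff [Finite ι] {T T' : Set (Tile d M)} (hT : T ∈ Φ.tilingSpace)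
    (hT' : T' ∈ Φ.tilingSpace) : Φ.StablyEquiv T T' ↔ Φ.EventuallyAgree T T' 0 :=
  ⟨eventuallyAgree_of_stablyEquiv hT hT', stablyEquiv_of_eventuallyAgree hT hT'⟩

end SelfSimilarSubstitution

namespace SelfSimilarSubstitution

open SubstTiling

variable {d : ℕ} {M ι : Type*} {Φ : SelfSimilarSubstitution d M ι}

/-! ### Repulsion: supertiles do not overlap their own small translates -/

theorem exists_of_mem_iterate_app {P : Set (Tile d M)} {k : ℕ} {σ : Tile d M}
    (hσ : σ ∈ Φ.app^[k] P) {x : Space d} (hx : x ∈ σ.support) :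
    ∃ τ ∈ P, (Φ.ratio ^ k)⁻¹ • x ∈ τ.support := by
  induction k generalizing σ x with
  | zero => exact ⟨σ, hσ, by simpa using hx⟩
  | succ k ih =>
    rw [Function.iterate_succ_apply'] at hσ
    obtain ⟨i, v, hv, hσ'⟩ := hσ
    obtain ⟨τ, hτ, h⟩ := ih hv (supp_subst_translate hσ' hx)
    refine ⟨τ, hτ, ?_⟩
    rwa [smul_smul, ← mul_inv, ← pow_succ] at h

theorem norm_ratio_pow_smul (k : ℕ) (x : Space d) :
    ‖Φ.ratio ^ k • x‖ = Φ.ratio ^ k * ‖x‖ := by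
  rw [norm_smul, norm_pow, Real.norm_of_nonneg Φ.ratio_pos.le]

theorem agreeAt_iterate_app_ball {T T' : Set (Tile d M)} {R : ℝ}
    (h : ∀ x, ‖x‖ < R → AgreeAt T T' x) (k : ℕ) {x : Space d} (hx : ‖x‖ < Φ.ratio ^ k * R) :
    AgreeAt (Φ.app^[k] T) (Φ.app^[k] T') x := by
  have hpos : 0 < Φ.ratio ^ k := pow_pos Φ.ratio_pos k
  have h1 : ‖(Φ.ratio ^ k)⁻¹ • x‖ < R := by
    rw [norm_smul, norm_inv, Real.norm_of_nonneg hpos.le, inv_mul_lt_iff₀ hpos]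
    exact hx
  have h2 := agreeAt_iterate_app (Φ := Φ) (h _ h1) k
  rwa [smul_inv_smul₀ hpos.ne'] at h2

/-- Up to translation, all patches of radius `1` of a tiling occur in one finite patch. -/
theorem exists_finite_patch [Finite ι] (hflc : HasFLC Φ.tilingSpace) {T : Set (Tile d M)}
    (hT : T ∈ Φ.tilingSpace) : ∃ P ⊆ T, P.Finite ∧ ∀ x : Space d, ∃ z : Space d,
      translate (ballPatch 1 (shift T x)) z ⊆ P := by
  obtain ⟨F, hF, hFT⟩ := exists_ballPatch_types hflc 1
  choose Q hQF v hv using fun x : Space d => hFT _ (shift_mem hT x)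
  have hfin : (Set.range Q).Finite := hF.subset (Set.range_subset_iff.2 hQF)
  choose! rep hrep using fun (q : Set (Tile d M)) (hq : q ∈ Set.range Q) => hq
  refine ⟨⋃ q ∈ Set.range Q, translate (ballPatch 1 (shift T (rep q))) (rep q), ?_, ?_, ?_⟩
  · refine Set.iUnion₂_subset fun q _ => ?_
    have := translate_mono (ballPatch_subset 1 (shift T (rep q))) (rep q)
    simpa [shift_eq] using this
  · exact hfin.biUnion fun q _ => (finite_ballPatch (shift_mem hT _) 1).image _
  · intro x
    refine ⟨v (rep (Q x)) - v x + rep (Q x), ?_⟩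
    have h1 : Q (rep (Q x)) = Q x := hrep (Q x) ⟨x, rfl⟩
    have h2 : translate (ballPatch 1 (shift T x)) (v (rep (Q x)) - v x + rep (Q x)) =
        translate (ballPatch 1 (shift T (rep (Q x)))) (rep (Q x)) := by
      rw [hv x, hv (rep (Q x)), h1]
      simp only [SubstTiling.translate_translate]
      congr 1
      abel
    rw [h2]
    exact Set.subset_biUnion_of_mem (u := fun q => translate (ballPatch 1 (shift T (rep q))) (rep q))
      ⟨x, rfl⟩

/-- Up to translation, all patches of radius `1` of a tiling occur in one supertile of each type. -/
theorem exists_supertile [Finite ι] (hprim : Φ.IsPrimitive) (hflc : HasFLC Φ.tilingSpace)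
    {T : Set (Tile d M)} (hT : T ∈ Φ.tilingSpace) (i : ι) : ∃ k : ℕ, ∀ x : Space d, ∃ z : Space d,
      translate (ballPatch 1 (shift T x)) z ⊆ Φ.app^[k] {Φ.proto i} := by
  obtain ⟨P, hPT, hP, hPx⟩ := exists_finite_patch hflc hT
  obtain ⟨m, -, j, v, hv⟩ := hT.2 P hPT hP
  obtain ⟨n, w, hw⟩ := hprim j i
  refine ⟨m + n, fun x => ?_⟩
  obtain ⟨z, hz⟩ := hPx x
  refine ⟨z + v + Φ.ratio ^ m • w, ?_⟩
  have h1 : translate {Φ.proto j} w ⊆ Φ.app^[n] {Φ.proto i} := by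
    rintro _ ⟨τ, rfl, rfl⟩
    exact hw
  have h2 := iterate_app_mono (Φ := Φ) h1 m
  rw [iterate_app_translate, ← Function.iterate_add_apply] at h2
  refine Set.Subset.trans ?_ h2
  have h3 := translate_mono (hz.trans hv) (v + Φ.ratio ^ m • w)
  simpa [shift_eq, add_assoc] using h3

/-- A supertile of fixed order over the tile of `S` at the origin contains a copy of every unit
patch of a reference tiling `T`. Overlap of `Φ^m(S)` with its own translate on a large ball
therefore becomes, at every point, a translational period of `Φ^m(T)`. -/
theorem exists_repulsion [Finite ι] (hprim : Φ.IsPrimitive) (hflc : HasFLC Φ.tilingSpace)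
    (hnonper : IsNonPeriodic Φ.tilingSpace) (hne : Φ.tilingSpace.Nonempty) :
    ∃ ε : ℝ, 0 < ε ∧ ∃ C : ℝ, 0 < C ∧ ∀ S ∈ Φ.tilingSpace, ∀ (m : ℕ) (w : Space d), ‖w‖ < ε →
      (∀ x, ‖x‖ < Φ.ratio ^ m * C →
        AgreeAt (Φ.app^[m] S) (translate (Φ.app^[m] S) (Φ.ratio ^ m • w)) x) → w = 0 := by
  obtain ⟨T, hT⟩ := hne
  obtain ⟨D, hD, hDb⟩ := Φ.exists_diam_bound
  choose k hk using exists_supertile hprim hflc hT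
  obtain ⟨K, hK⟩ := Finite.exists_le k
  have hlam := Φ.ratio_pos
  -- The first bound makes `W` shorter than `ratio ^ m`, the size of an inflated unit patch; a ball
  -- of radius `D + 1` contains the tile at the origin, so its inflation contains the supertile.
  refine ⟨(Φ.ratio ^ K)⁻¹, by positivity, D + 1, by positivity, fun S hS m w hw hag => ?_⟩
  obtain ⟨τ, hτ, h0τ⟩ := hS.1.exists_mem 0
  obtain ⟨i, a, rfl⟩ := generated_of_mem hS τ hτ
  set W : Space d := Φ.ratio ^ (k i + m) • w with hW
  have hagk : ∀ x, ‖x‖ < Φ.ratio ^ (k i + m) * (D + 1) →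
      AgreeAt (Φ.app^[k i + m] S) (translate (Φ.app^[k i + m] S) W) x := by
    intro x hx
    rw [pow_add, mul_assoc] at hx
    have := agreeAt_iterate_app_ball hag (k i) hx
    rwa [iterate_app_translate, smul_smul, ← pow_add, ← Function.iterate_add_apply] at this
  have hWnorm : ‖W‖ < Φ.ratio ^ m := by
    rw [hW, norm_ratio_pow_smul, pow_add]
    have h1 : Φ.ratio ^ k i ≤ Φ.ratio ^ K := pow_le_pow_right₀ Φ.one_lt_ratio.le (hK i)
    have h2 : Φ.ratio ^ k i * ‖w‖ < 1 := by
      have h3 : ‖w‖ * Φ.ratio ^ K < 1 := by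
        rwa [← one_div, lt_div_iff₀ (by positivity)] at hw
      nlinarith [norm_nonneg w]
    have h3 : 0 < Φ.ratio ^ m := by positivity
    nlinarith
  -- The patch of `T` at `x` occurs in the supertile of `S`. After `Φ^m`, compare `T` with `S`, use
  -- the overlap in `S`, and return to `T`; the return takes place at `-W`, still inside the
  -- inflated unit patch.
  have hper : ∀ x : Space d, AgreeAt (Φ.app^[m] T) (translate (Φ.app^[m] T) W)
      (Φ.ratio ^ m • x) := by
    intro x
    obtain ⟨z, hz⟩ := hk i x
    set y : Space d := -(z + Φ.ratio ^ k i • a) with hy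
    have hsub : translate (ballPatch 1 (shift T x)) (-y) ⊆
        Φ.app^[k i] {(Φ.proto i).translate a} := by
      have h1 : ({(Φ.proto i).translate a} : Set (Tile d M)) = translate {Φ.proto i} a := by
        simp [SubstTiling.translate]
      rw [h1, iterate_app_translate]
      simpa [hy] using translate_mono hz (Φ.ratio ^ k i • a)
    have hyn : ‖y‖ < Φ.ratio ^ k i * (D + 1) := by
      obtain ⟨σ, hσ, h0σ⟩ := (shift_mem hT x).1.exists_mem 0
      have h1 : σ.translate (-y) ∈ Φ.app^[k i] {(Φ.proto i).translate a} :=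
        hsub ⟨σ, mem_ballPatch hσ h0σ (by simp), rfl⟩
      obtain ⟨_, rfl, h2⟩ := exists_of_mem_iterate_app h1 (x := -y)
        (by rw [Tile.mem_support_translate]; simpa using h0σ)
      have h3 := hDb S (generated_of_mem hS) _ hτ _ h2 _ h0τ
      rw [sub_zero, norm_smul, norm_neg, norm_inv, Real.norm_of_nonneg (by positivity),
        inv_mul_le_iff₀ (by positivity)] at h3
      have : 0 < Φ.ratio ^ k i := by positivity
      linarith
    have hSmem : translate (Φ.app^[k i] S) y ∈ Φ.tilingSpace := translate_mem (iterate_app_mem hS _) _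
    have hBsub : ballPatch 1 (shift T x) ⊆ translate (Φ.app^[k i] S) y := by
      have h1 := translate_mono (hsub.trans (iterate_app_mono (Set.singleton_subset_iff.2 hτ) _)) y
      simpa using h1
    have hB : ∀ z, ‖z‖ < 1 → AgreeAt (shift T x) (translate (Φ.app^[k i] S) y) z := fun z hz =>
      agreeAt_of_ballPatch_subset (shift_mem hT x).1 (generated_of_mem (shift_mem hT x))
        hSmem.1.1 (generated_of_mem hSmem) hBsub hz
    have hBm : ∀ z, ‖z‖ < Φ.ratio ^ m → AgreeAt (translate (Φ.app^[m] T) (-(Φ.ratio ^ m • x)))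
        (translate (Φ.app^[k i + m] S) (Φ.ratio ^ m • y)) z := by
      intro z hz
      have := agreeAt_iterate_app_ball hB m (x := z) (by simpa using hz)
      rwa [shift_eq, iterate_app_translate, iterate_app_translate, smul_neg,
        ← Function.iterate_add_apply, add_comm m] at this
    have e1 := hBm 0 (by simpa using pow_pos hlam m)
    have e2 : AgreeAt (translate (Φ.app^[k i + m] S) (Φ.ratio ^ m • y))
        (translate (translate (Φ.app^[k i + m] S) (Φ.ratio ^ m • y)) W) 0 := by
      rw [SubstTiling.translate_translate, add_comm (Φ.ratio ^ m • y),
        ← SubstTiling.translate_translate, agreeAt_translate]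
      apply hagk
      rw [zero_sub, norm_neg, norm_ratio_pow_smul, pow_add]
      have : 0 < Φ.ratio ^ m := by positivity
      nlinarith
    have e3 := hBm (-W) (by simpa using hWnorm)
    have e4 : AgreeAt (translate (translate (Φ.app^[m] T) (-(Φ.ratio ^ m • x))) W)
        (translate (translate (Φ.app^[k i + m] S) (Φ.ratio ^ m • y)) W) 0 := by
      rw [agreeAt_translate]; simpa using e3
    have e5 := e1.trans (e2.trans e4.symm)
    rw [SubstTiling.translate_translate, add_comm (-(Φ.ratio ^ m • x)),
      ← SubstTiling.translate_translate, agreeAt_translate] at e5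
    simpa using e5
  have hTm := iterate_app_mem hT m
  have heq : Φ.app^[m] T = translate (Φ.app^[m] T) W := by
    refine eq_of_agreeAt_of_mem hTm (translate_mem hTm W) fun x => ?_
    have := hper ((Φ.ratio ^ m)⁻¹ • x)
    rwa [smul_inv_smul₀ (pow_pos hlam m).ne'] at this
  have hW0 := hnonper _ hTm (-W) (by rw [shift_eq, neg_neg]; exact heq.symm)
  rw [neg_eq_zero, hW, smul_eq_zero] at hW0
  exact hW0.resolve_left (pow_pos hlam _).ne'

/-! ### Uniform agreement -/

theorem agreeAt_of_ballPatch_eq_translate {A A' G : Set (Tile d M)} {R : ℝ} {b b' : Space d}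
    (h : ballPatch R A = translate G b) (h' : ballPatch R A' = translate G b') {x : Space d}
    (hx : ‖x‖ < R) (hx' : ‖x - (b' - b)‖ < R) : AgreeAt (translate A (b' - b)) A' x := by
  intro τ hτ
  have h1 : τ ∈ A' ↔ τ.translate (-b') ∈ G := by
    rw [← mem_translate (P := G), ← h']
    exact ⟨fun h => mem_ballPatch h hτ hx, fun h => h.1⟩
  have h2 : τ.translate (-(b' - b)) ∈ A ↔ (τ.translate (-(b' - b))).translate (-b) ∈ G := by
    rw [← mem_translate (P := G), ← h]
    refine ⟨fun h => mem_ballPatch h (x := x - (b' - b)) ?_ hx', fun h => h.1⟩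
    rw [Tile.mem_support_translate, sub_neg_eq_add, sub_add_cancel]
    exact hτ
  rw [h1, mem_translate, h2, Tile.translate_translate]
  have : -(b' - b) + -b = -b' := by abel
  rw [this]

theorem exists_tendsto_hyperfilter {E : Type*} [NormedAddCommGroup E] [ProperSpace E]
    {b : ℕ → E} {R : ℝ}
    (h : ∀ᶠ n in (hyperfilter ℕ : Filter ℕ), ‖b n‖ ≤ R) :
    ∃ a, Tendsto b (hyperfilter ℕ : Filter ℕ) (𝓝 a) := by
  have h1 : ((hyperfilter ℕ).map b : Filter E) ≤ 𝓟 (Metric.closedBall 0 R) := by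
    rw [le_principal_iff, Ultrafilter.coe_map, mem_map]
    filter_upwards [h] with n hn
    simpa using hn
  obtain ⟨a, -, ha⟩ := (isCompact_closedBall (0 : E) R).ultrafilter_le_nhds _ h1
  exact ⟨a, ha⟩

theorem exists_ballPatch_eq_tendsto [Finite ι] (hflc : HasFLC Φ.tilingSpace)
    {S : ℕ → Set (Tile d M)} (hS : ∀ n, S n ∈ Φ.tilingSpace) {R : ℝ} (hR : 0 < R) :
    ∃ n₀, ∃ (b : ℕ → Space d) (a : Space d), Tendsto b (hyperfilter ℕ : Filter ℕ) (𝓝 a) ∧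
      ∀ᶠ n in (hyperfilter ℕ : Filter ℕ),
        ballPatch R (S n) = translate (ballPatch R (S n₀)) (b n) := by
  obtain ⟨D, hD, hDb⟩ := Φ.exists_diam_bound
  obtain ⟨n₀, b, hb⟩ := exists_eventually_ballPatch_eq hflc hS R
  have hbd : ∀ᶠ n in (hyperfilter ℕ : Filter ℕ), ‖b n‖ ≤ R + D := by
    filter_upwards [hb] with n hn
    obtain ⟨τ, hτ, h0⟩ := (hS n₀).1.exists_mem 0
    have h1 : τ.translate (b n) ∈ ballPatch R (S n) := by
      rw [hn]
      exact ⟨τ, mem_ballPatch hτ h0 (by simpa using hR), rfl⟩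
    obtain ⟨hmem, y, hyR, hy⟩ := h1
    have h2 : ‖y‖ < R := by simpa using hyR
    rw [Tile.mem_support_translate] at hy
    have h3 := hDb _ (generated_of_mem (hS n₀)) τ hτ _ hy _ h0
    rw [sub_zero] at h3
    have := norm_sub_le y (y - b n)
    rw [sub_sub_cancel] at this
    linarith
  obtain ⟨a, ha⟩ := exists_tendsto_hyperfilter hbd
  exact ⟨n₀, b, a, ha, hb⟩

theorem eventually_norm_sub_lt {b : ℕ → Space d} {a : Space d}
    (ha : Tendsto b (hyperfilter ℕ : Filter ℕ) (𝓝 a)) {δ : ℝ} (hδ : 0 < δ) :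
    ∀ᶠ n in (hyperfilter ℕ : Filter ℕ), ‖b n - a‖ < δ := by
  filter_upwards [ha (Metric.ball_mem_nhds a hδ)] with n hn
  simpa [dist_eq_norm] using hn

/-- Almost recurrence of patches along a sequence of tilings. -/
theorem eventually_eventually_agreeAt [Finite ι] (hflc : HasFLC Φ.tilingSpace)
    {S : ℕ → Set (Tile d M)} (hS : ∀ n, S n ∈ Φ.tilingSpace) {R δ : ℝ} (hR : 0 < R) (hδ : 0 < δ) :
    ∀ᶠ n in (hyperfilter ℕ : Filter ℕ), ∀ᶠ m in (hyperfilter ℕ : Filter ℕ),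
      ∃ e : Space d, ‖e‖ < δ ∧ ∀ x, ‖x‖ < R - δ → AgreeAt (translate (S n) e) (S m) x := by
  obtain ⟨n₀, b, a, ha, hb⟩ := exists_ballPatch_eq_tendsto hflc hS hR
  have hnear := eventually_norm_sub_lt ha (half_pos hδ)
  filter_upwards [hb, hnear] with n hn hna
  filter_upwards [hb, hnear] with m hm hma
  have hlt : ‖b m - b n‖ < δ := by
    have := norm_sub_le (b m - a) (b n - a)
    rw [sub_sub_sub_cancel_right] at this
    linarith
  refine ⟨b m - b n, hlt, fun x hx => agreeAt_of_ballPatch_eq_translate hn hm (by linarith) ?_⟩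
  linarith [norm_sub_le x (b m - b n)]

/-- Almost recurrence of pairs of patches along a sequence of pairs of tilings that share a tile
near the origin. -/
theorem exists_recurrence_pair [Finite ι] (hflc : HasFLC Φ.tilingSpace)
    {S S' : ℕ → Set (Tile d M)} (hS : ∀ n, S n ∈ Φ.tilingSpace) (hS' : ∀ n, S' n ∈ Φ.tilingSpace)
    {R δ : ℝ} (hδ : 0 < δ) (hag : ∀ n, ∃ x : Space d, ‖x‖ < R ∧ AgreeAt (S n) (S' n) x) :
    ∃ b : ℕ → Space d, ∃ I ∈ hyperfilter ℕ, ∀ n ∈ I, ∀ m ∈ I, ‖b m - b n‖ < δ ∧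
      ∀ x, ‖x‖ < R - δ → AgreeAt (translate (S n) (b m - b n)) (S m) x ∧
        AgreeAt (translate (S' n) (b m - b n)) (S' m) x := by
  have hR : 0 < R := by
    obtain ⟨x, hx, -⟩ := hag 0
    exact (norm_nonneg x).trans_lt hx
  obtain ⟨n₀, b, a, ha, hb⟩ := exists_ballPatch_eq_tendsto hflc hS hR
  obtain ⟨n₀', b', a', ha', hb'⟩ := exists_ballPatch_eq_tendsto hflc hS' hR
  -- A tile common to both members ties their translations: along the ultrafilter it comes from one
  -- fixed pair of tiles, so `b n - b' n` is constant and both members move by the same vector.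
  have hpair : ∀ᶠ n in (hyperfilter ℕ : Filter ℕ), ∃ q ∈ ballPatch R (S n₀) ×ˢ ballPatch R (S' n₀'),
      q.1.translate (b n) = q.2.translate (b' n) := by
    filter_upwards [hb, hb'] with n hn hn'
    obtain ⟨x, hx, hagx⟩ := hag n
    obtain ⟨τ, hτ, hxτ⟩ := (hS n).1.exists_mem x
    have h1 := mem_ballPatch hτ hxτ hx
    have h2 := mem_ballPatch ((hagx τ hxτ).1 hτ) hxτ hx
    rw [hn, mem_translate] at h1
    rw [hn', mem_translate] at h2
    exact ⟨(τ.translate (-b n), τ.translate (-b' n)), ⟨h1, h2⟩, by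
      simp only [Tile.translate_translate, neg_add_cancel]⟩
  obtain ⟨⟨σ, σ'⟩, ⟨hσ, hσ'⟩, hq⟩ := (Ultrafilter.eventually_exists_mem_iff
    ((finite_ballPatch (hS n₀) R).prod (finite_ballPatch (hS' n₀') R))).1 hpair
  have hnear := eventually_norm_sub_lt ha (half_pos hδ)
  refine ⟨b, _, hb.and (hb'.and (hq.and hnear)), ?_⟩
  rintro n ⟨hn, hn', hqn, hna⟩ m ⟨hm, hm', hqm, hma⟩
  have hlt : ‖b m - b n‖ < δ := by
    have := norm_sub_le (b m - a) (b n - a)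
    rw [sub_sub_sub_cancel_right] at this
    linarith
  have hdiff : ∀ n, σ.translate (b n) = σ'.translate (b' n) → σ.translate (b n - b' n) = σ' := by
    intro n hn
    have := congrArg (fun t => Tile.translate t (-b' n)) hn
    simpa [sub_eq_add_neg] using this
  have heq : b n - b' n = b m - b' m := (generated_of_mem (hS n₀)).translate_injective hσ.1
    ((hdiff n hqn).trans (hdiff m hqm).symm)
  have heq' : b' m - b' n = b m - b n := by
    have h1 : b' m - b' n = (b m - b n) + ((b n - b' n) - (b m - b' m)) := by abel
    rw [h1, heq, sub_self, add_zero]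
  refine ⟨hlt, fun x hx => ?_⟩
  have hx1 : ‖x‖ < R := by linarith
  have hx2 : ‖x - (b m - b n)‖ < R := by linarith [norm_sub_le x (b m - b n)]
  refine ⟨agreeAt_of_ballPatch_eq_translate hn hm hx1 hx2, ?_⟩
  have := agreeAt_of_ballPatch_eq_translate hn' hm' hx1 (by rwa [heq'])
  rwa [heq'] at this

/-- If some power of the substitution makes two tilings agree on a large ball (at the scale of that
power), then so does a power independent of the tilings, at the origin. -/
theorem exists_uniform_agreeAt [Finite ι] (hprim : Φ.IsPrimitive) (hflc : HasFLC Φ.tilingSpace)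
    (hnonper : IsNonPeriodic Φ.tilingSpace) (hne : Φ.tilingSpace.Nonempty) :
    ∃ (J : ℕ) (C : ℝ), 0 < C ∧ ∀ S ∈ Φ.tilingSpace, ∀ S' ∈ Φ.tilingSpace, ∀ j : ℕ,
      (∀ x, ‖x‖ < Φ.ratio ^ j * C → AgreeAt (Φ.app^[j] S) (Φ.app^[j] S') x) →
        AgreeAt (Φ.app^[J] S) (Φ.app^[J] S') 0 := by
  obtain ⟨ε, hε, C₀, hC₀, hrep⟩ := exists_repulsion hprim hflc hnonper hne
  set δ := min (ε / 2) (1 / 2) with hδ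
  have hδpos : 0 < δ := by positivity
  have hδε : δ ≤ ε / 2 := min_le_left _ _
  have hδ1 : δ ≤ 1 / 2 := min_le_right _ _
  -- Take a counterexample for every exponent `J`. Recurrence compares two of them, `n` and `m`,
  -- where `m` exceeds the power `j n` after which the `n`-th pair agrees.
  by_contra! hcon
  choose S hS S' hS' j hj hnot using fun J => hcon J (C₀ + 1) (by positivity)
  obtain ⟨n, hn, hn'⟩ := ((eventually_eventually_agreeAt hflc hS (R := C₀ + 1) (by positivity) hδpos).and
    (eventually_eventually_agreeAt hflc hS' (R := C₀ + 1) (by positivity) hδpos)).exists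
  have hge : ∀ᶠ m in (hyperfilter ℕ : Filter ℕ), j n ≤ m :=
    (eventually_ge_atTop _).filter_mono Nat.hyperfilter_le_atTop
  obtain ⟨m, ⟨e, he, hag⟩, ⟨e', he', hag'⟩, hjm⟩ := (hn.and (hn'.and hge)).exists
  have hpow : ∀ k : ℕ, 0 < Φ.ratio ^ k := fun k => pow_pos Φ.ratio_pos k
  -- agreement persists under further substitution
  have hlift : ∀ (i k : ℕ), j i ≤ k → ∀ x, ‖x‖ < Φ.ratio ^ k * (C₀ + 1) →
      AgreeAt (Φ.app^[k] (S i)) (Φ.app^[k] (S' i)) x := by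
    intro i k hik x hx
    obtain ⟨l, rfl⟩ := Nat.exists_eq_add_of_le' hik
    rw [pow_add, mul_assoc] at hx
    rw [Function.iterate_add_apply, Function.iterate_add_apply]
    exact agreeAt_iterate_app_ball (hj i) l hx
  have hE : ∀ (k : ℕ) x, ‖x‖ < Φ.ratio ^ k * (C₀ + 1 - δ) →
      AgreeAt (translate (Φ.app^[k] (S n)) (Φ.ratio ^ k • e)) (Φ.app^[k] (S m)) x := by
    intro k x hx
    rw [← iterate_app_translate]
    exact agreeAt_iterate_app_ball hag k hx
  have hE' : ∀ (k : ℕ) x, ‖x‖ < Φ.ratio ^ k * (C₀ + 1 - δ) →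
      AgreeAt (translate (Φ.app^[k] (S' n)) (Φ.ratio ^ k • e')) (Φ.app^[k] (S' m)) x := by
    intro k x hx
    rw [← iterate_app_translate]
    exact agreeAt_iterate_app_ball hag' k hx
  -- At a power `k` beyond both `j n` and `j m`, going from `S n` to `S m`, to `S' m`, to `S' n` and
  -- back to `S n` shows that `Φ^k(S n)` overlaps its translate by `ratio ^ k • (e' - e)`, which
  -- repulsion forbids unless the displacement is zero.
  have hee : e' - e = 0 := by
    set k := j n + j m with hk
    refine hrep (S n) (hS n) k (e' - e) (by linarith [norm_sub_le e' e]) fun x hx => ?_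
    have hy : ‖x + Φ.ratio ^ k • e‖ < Φ.ratio ^ k * (C₀ + δ) := by
      refine (norm_add_le _ _).trans_lt ?_
      rw [norm_ratio_pow_smul]
      nlinarith [hpow k]
    have hy1 : ‖x + Φ.ratio ^ k • e‖ < Φ.ratio ^ k * (C₀ + 1 - δ) :=
      hy.trans_le (mul_le_mul_of_nonneg_left (by linarith) (hpow k).le)
    have hy2 : ‖x + Φ.ratio ^ k • e‖ < Φ.ratio ^ k * (C₀ + 1) :=
      hy.trans_le (mul_le_mul_of_nonneg_left (by linarith) (hpow k).le)
    have h1 := hE k _ hy1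
    have h2 := hlift m k (by omega) _ hy2
    have h3 := (hE' k _ hy1).symm
    have h4 : AgreeAt (translate (Φ.app^[k] (S' n)) (Φ.ratio ^ k • e'))
        (translate (Φ.app^[k] (S n)) (Φ.ratio ^ k • e')) (x + Φ.ratio ^ k • e) := by
      rw [agreeAt_translate]
      refine (hlift n k (by omega) _ ?_).symm
      refine (norm_sub_le _ _).trans_lt ?_
      rw [norm_ratio_pow_smul]
      nlinarith [hpow k]
    have h5 := h1.trans (h2.trans (h3.trans h4))
    have h6 : translate (Φ.app^[k] (S n)) (Φ.ratio ^ k • e') =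
        translate (translate (Φ.app^[k] (S n)) (Φ.ratio ^ k • (e' - e))) (Φ.ratio ^ k • e) := by
      rw [SubstTiling.translate_translate, smul_sub, sub_add_cancel]
    rw [h6, agreeAt_translate, add_sub_cancel_right] at h5
    exact h5
  obtain rfl : e' = e := sub_eq_zero.1 hee
  apply hnot m
  have h0 : ‖(0 : Space d)‖ < Φ.ratio ^ m * (C₀ + 1 - δ) := by
    rw [norm_zero]
    exact mul_pos (hpow m) (by linarith)
  -- With equal displacements, the agreement of the `n`-th pair at power `m ≥ j n` carries over to
  -- the `m`-th pair, contradicting its choice.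
  refine (hE m 0 h0).symm.trans (AgreeAt.trans ?_ (hE' m 0 h0))
  rw [agreeAt_translate]
  apply hlift n m hjm
  rw [zero_sub, norm_neg, norm_ratio_pow_smul]
  exact mul_lt_mul_of_pos_left (by linarith) (hpow m)

/-- Tilings that are eventually equal on an open half-space are equal at a bounded distance from
its boundary. -/
theorem exists_agreeAt_halfSpace [Finite ι] (hprim : Φ.IsPrimitive) (hflc : HasFLC Φ.tilingSpace)
    (hnonper : IsNonPeriodic Φ.tilingSpace) :
    ∃ c : ℝ, 0 < c ∧ ∀ T ∈ Φ.tilingSpace, ∀ T' ∈ Φ.tilingSpace, ∀ u : Space d, ‖u‖ = 1 →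
      (∀ x, 0 < inner ℝ x u → Φ.EventuallyAgree T T' x) → ∀ x, c < inner ℝ x u → AgreeAt T T' x := by
  rcases Φ.tilingSpace.eq_empty_or_nonempty with hne | hne
  · exact ⟨1, one_pos, fun T hT => by simp [hne] at hT⟩
  obtain ⟨J, C, hC, hJ⟩ := exists_uniform_agreeAt hprim hflc hnonper hne
  have hpow : 0 < Φ.ratio ^ J := pow_pos Φ.ratio_pos J
  -- Desubstituting `J` times brings `x` to distance more than `C` from the boundary. On the
  -- `C`-ball there, compactness gives agreement after some power `j` depending on the tilings,
  -- which the uniform lemma replaces by `J`.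
  refine ⟨Φ.ratio ^ J * C, by positivity, fun T hT T' hT' u hu h x hx => ?_⟩
  have hpre : ∀ T ∈ Φ.tilingSpace, ∃ S ∈ Φ.tilingSpace, Φ.app^[J] S = T := by
    intro T hT
    obtain ⟨S, hS, h0, hsucc⟩ := exists_iterate_app_eq hprim hflc hT
    have : ∀ n, Φ.app^[n] (S n) = T := by
      intro n
      induction n with
      | zero => exact h0
      | succ n ih => rw [Function.iterate_succ_apply, hsucc, ih]
    exact ⟨S J, hS J, this J⟩
  obtain ⟨S, hS, rfl⟩ := hpre T hT
  obtain ⟨S', hS', rfl⟩ := hpre T' hT'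
  obtain ⟨z, rfl⟩ : ∃ z : Space d, x = Φ.ratio ^ J • z :=
    ⟨(Φ.ratio ^ J)⁻¹ • x, by rw [smul_inv_smul₀ hpow.ne']⟩
  rw [real_inner_smul_left, mul_lt_mul_iff_right₀ hpow] at hx
  have hball : ∀ y ∈ Metric.closedBall (0 : Space d) C,
      Φ.EventuallyAgree (shift S z) (shift S' z) y := by
    intro y hy
    rw [eventuallyAgree_shift, ← eventuallyAgree_iterate_app J]
    apply h
    rw [real_inner_smul_left, inner_add_left]
    have h1 := abs_real_inner_le_norm y u
    rw [hu, mul_one] at h1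
    have h2 : ‖y‖ ≤ C := by simpa using hy
    have := neg_abs_le (inner ℝ y u)
    exact mul_pos hpow (by linarith)
  obtain ⟨j, hj⟩ := exists_agreeAt_of_isCompact (shift_mem hS z) (shift_mem hS' z)
    (isCompact_closedBall 0 C) hball
  have hpowj : 0 < Φ.ratio ^ j := pow_pos Φ.ratio_pos j
  have h1 := hJ _ (shift_mem hS z) _ (shift_mem hS' z) j fun x hx => by
    have h2 : (Φ.ratio ^ j)⁻¹ • x ∈ Metric.closedBall (0 : Space d) C := by
      rw [mem_closedBall_zero_iff, norm_smul, norm_inv, Real.norm_of_nonneg hpowj.le,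
        inv_mul_le_iff₀ hpowj]
      exact hx.le
    have h3 := hj _ h2
    rwa [smul_inv_smul₀ hpowj.ne'] at h3
  rw [shift_eq, shift_eq, iterate_app_translate, iterate_app_translate, agreeAt_translate] at h1
  simpa using h1

end SelfSimilarSubstitution

namespace SelfSimilarSubstitution

open SubstTiling

variable {d : ℕ} {M ι : Type*} {Φ : SelfSimilarSubstitution d M ι}

/-! ### Branch pairs in terms of eventual agreement -/

theorem stableOnHalfSpace_iff [Finite ι] {T T' : Set (Tile d M)} (hT : T ∈ Φ.tilingSpace)
    (hT' : T' ∈ Φ.tilingSpace) {u : Direction d} :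
    Φ.StableOnHalfSpace T T' u ↔
      ∀ x, 0 < inner ℝ x (u : Space d) → Φ.EventuallyAgree T T' x := by
  simp only [StableOnHalfSpace, stablyEquiv_shift_iff hT hT']

theorem mem_branchPairs_iff [Finite ι] {T T' : Set (Tile d M)} :
    (T, T') ∈ Φ.branchPairs ↔ T ∈ Φ.tilingSpace ∧ T' ∈ Φ.tilingSpace ∧
      ¬ Φ.EventuallyAgree T T' 0 ∧ ∃ u : Direction d, ∀ x, 0 < inner ℝ x (u : Space d) →
        Φ.EventuallyAgree T T' x := by
  constructor
  · rintro ⟨hT, hT', h0, u, hu⟩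
    exact ⟨hT, hT', fun h => h0 ((stablyEquiv_iff hT hT').2 h), u,
      (stableOnHalfSpace_iff hT hT').1 hu⟩
  · rintro ⟨hT, hT', h0, u, hu⟩
    exact ⟨hT, hT', fun h => h0 ((stablyEquiv_iff hT hT').1 h), u,
      (stableOnHalfSpace_iff hT hT').2 hu⟩

/-- The open hemisphere about `u`. -/
def hemisphere (u : Direction d) : Set (Direction d) := {w | 0 < inner ℝ (w : Space d) (u : Space d)}

theorem isOpen_hemisphere (u : Direction d) : IsOpen (hemisphere u) :=
  isOpen_lt continuous_const (continuous_subtype_val.inner continuous_const)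

theorem self_mem_hemisphere (u : Direction d) : u ∈ hemisphere u := by
  change 0 < inner ℝ (u : Space d) (u : Space d)
  rw [real_inner_self_eq_norm_sq, norm_eq_of_mem_sphere u]
  norm_num

/-- It is the radial projection of a convex open half-space. -/
theorem isPreconnected_hemisphere (u : Direction d) : IsPreconnected (hemisphere u) := by
  have hconv : Convex ℝ {x : Space d | 0 < inner ℝ x (u : Space d)} := by
    intro x hx y hy a b ha hb hab
    change 0 < inner ℝ x (u : Space d) at hx
    change 0 < inner ℝ y (u : Space d) at hy
    change 0 < inner ℝ (a • x + b • y) (u : Space d)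
    rw [inner_add_left, real_inner_smul_left, real_inner_smul_left]
    rcases ha.eq_or_lt with rfl | ha
    · rw [zero_add] at hab
      simpa [hab] using hy
    · have := mul_pos ha hx
      have := mul_nonneg hb hy.le
      linarith
  have : PreconnectedSpace {x : Space d | 0 < inner ℝ x (u : Space d)} :=
    Subtype.preconnectedSpace hconv.isPreconnected
  have hne : ∀ x : {x : Space d | 0 < inner ℝ x (u : Space d)}, (x : Space d) ≠ 0 := by
    rintro ⟨x, hx⟩ rfl
    simp at hx
  let f : {x : Space d | 0 < inner ℝ x (u : Space d)} → Direction d := fun x =>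
    ⟨‖(x : Space d)‖⁻¹ • (x : Space d), by
      rw [mem_sphere_zero_iff_norm, norm_smul, norm_inv, norm_norm,
        inv_mul_cancel₀ (norm_ne_zero_iff.2 (hne x))]⟩
  have hf : Continuous f := by
    have h1 : Continuous fun x : {x : Space d | 0 < inner ℝ x (u : Space d)} => (x : Space d) :=
      continuous_subtype_val
    exact Continuous.subtype_mk ((h1.norm.inv₀ fun x => norm_ne_zero_iff.2 (hne x)).smul h1) _
  have hrange : Set.range f = hemisphere u := by
    ext w
    constructor
    · rintro ⟨x, rfl⟩
      change 0 < inner ℝ (‖(x : Space d)‖⁻¹ • (x : Space d)) (u : Space d)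
      rw [real_inner_smul_left]
      exact mul_pos (inv_pos.2 (norm_pos_iff.2 (hne x))) x.2
    · intro hw
      refine ⟨⟨w, hw⟩, Subtype.ext ?_⟩
      simp [f]
  rw [← hrange]
  exact isPreconnected_range hf

theorem hemisphere_subset_stableDirections {T T' : Set (Tile d M)} {u : Direction d}
    (h : Φ.StableOnHalfSpace T T' u) : hemisphere u ⊆ Φ.stableDirections T T' := by
  intro w hw t ht
  apply h
  rw [real_inner_smul_left]
  exact mul_pos ht hw

theorem hemisphere_subset_component {T T' : Set (Tile d M)} {u : Direction d}
    (h : Φ.StableOnHalfSpace T T' u) :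
    hemisphere u ⊆ connectedComponentIn (Φ.stableDirections T T') u :=
  (isPreconnected_hemisphere u).subset_connectedComponentIn (self_mem_hemisphere u)
    (hemisphere_subset_stableDirections h)

theorem mem_closure_hemisphere {u v : Direction d}
    (h : inner ℝ (v : Space d) (u : Space d) = 0) : v ∈ closure (hemisphere u) := by
  have hvv : inner ℝ (v : Space d) (v : Space d) = 1 := by
    rw [real_inner_self_eq_norm_sq, norm_eq_of_mem_sphere v]; norm_num
  have huu : inner ℝ (u : Space d) (u : Space d) = 1 := by
    rw [real_inner_self_eq_norm_sq, norm_eq_of_mem_sphere u]; norm_num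
  have hne : ∀ s : ℝ, (v : Space d) + s • (u : Space d) ≠ 0 := by
    intro s hs
    have := congrArg (fun x => inner ℝ x (v : Space d)) hs
    rw [real_inner_comm] at h
    simp only [inner_add_left, real_inner_smul_left, inner_zero_left, hvv, h, mul_zero, add_zero]
      at this
    exact one_ne_zero this
  let g : ℝ → Direction d := fun s =>
    ⟨‖(v : Space d) + s • (u : Space d)‖⁻¹ • ((v : Space d) + s • (u : Space d)), by
      rw [mem_sphere_zero_iff_norm, norm_smul, norm_inv, norm_norm,
        inv_mul_cancel₀ (norm_ne_zero_iff.2 (hne s))]⟩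
  have hg : Continuous g := by
    have h1 : Continuous fun s : ℝ => (v : Space d) + s • (u : Space d) := by fun_prop
    exact Continuous.subtype_mk ((h1.norm.inv₀ fun s => norm_ne_zero_iff.2 (hne s)).smul h1) _
  have hg0 : g 0 = v := by
    apply Subtype.ext
    simp [g]
  have hlim : Tendsto g (𝓝[>] 0) (𝓝 v) := by
    have := (hg.tendsto 0).mono_left (nhdsWithin_le_nhds (s := Set.Ioi 0))
    rwa [hg0] at this
  refine mem_closure_of_tendsto hlim ?_
  filter_upwards [self_mem_nhdsWithin] with s hs
  change 0 < inner ℝ (‖(v : Space d) + s • (u : Space d)‖⁻¹ • ((v : Space d) + s • (u : Space d)))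
    (u : Space d)
  rw [real_inner_smul_left, inner_add_left, real_inner_smul_left, h, huu]
  have := norm_pos_iff.2 (hne s)
  have hs' : (0 : ℝ) < s := hs
  positivity

/-- Being orthogonal to `u`, the direction `v` is a limit of the hemisphere, hence of the sector; it
is not interior, because it is not itself a stable direction. -/
theorem mem_branchDirections [Finite ι] {T T' : Set (Tile d M)} (hT : T ∈ Φ.tilingSpace)
    (hT' : T' ∈ Φ.tilingSpace) {u v : Direction d}
    (hu : ∀ x, 0 < inner ℝ x (u : Space d) → Φ.EventuallyAgree T T' x)
    (hvu : inner ℝ (v : Space d) (u : Space d) = 0) {t : ℕ → ℝ} (ht : Tendsto t atTop atTop)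
    (h : ∀ i, ¬ Φ.EventuallyAgree T T' (t i • (v : Space d))) : v ∈ Φ.branchDirections T T' := by
  have hst := (stableOnHalfSpace_iff hT hT').2 hu
  have hns : ∀ i, ¬ Φ.StablyEquiv (shift T (t i • (v : Space d))) (shift T' (t i • (v : Space d))) :=
    fun i hi => h i ((stablyEquiv_shift_iff hT hT' _).1 hi)
  refine ⟨⟨_, ⟨u, hst, rfl⟩, ?_, ?_⟩, t, ht, hns⟩
  · exact closure_mono (hemisphere_subset_component hst) (mem_closure_hemisphere hvu)
  · intro hv
    obtain ⟨i, hi⟩ := (ht.eventually_gt_atTop 0).exists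
    exact hns i (connectedComponentIn_subset _ _ (interior_subset hv) (t i) hi)

/-! ### Tilings that are periodic under the substitution -/

theorem iterate_app_of_periodic {P : Set (Tile d M)} {k : ℕ} (h : Φ.app^[k] P = P) (j : ℕ) :
    Φ.app^[k * j] P = P := by
  rw [Function.iterate_mul]
  exact Function.iterate_fixed h j

theorem eventuallyAgree_of_periodic {P P' : Set (Tile d M)} {k : ℕ} (h : Φ.app^[k] P = P)
    (h' : Φ.app^[k] P' = P') (j : ℕ) {x : Space d} :
    Φ.EventuallyAgree P P' (Φ.ratio ^ (k * j) • x) ↔ Φ.EventuallyAgree P P' x := by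
  have := eventuallyAgree_iterate_app (Φ := Φ) (T := P) (T' := P') (x := x) (k * j)
  rwa [iterate_app_of_periodic h, iterate_app_of_periodic h'] at this

theorem tendsto_ratio_pow_mul {k : ℕ} (hk : 1 ≤ k) :
    Tendsto (fun j => Φ.ratio ^ (k * j)) atTop atTop := by
  refine (tendsto_pow_atTop_atTop_of_one_lt Φ.one_lt_ratio).comp ?_
  exact tendsto_id.const_mul_atTop' (by omega)

/-- The tilings `Φ^(k j)(Z)` and `Φ^(k (j + 1))(Z)` agree on a ball growing with `j`, so the
sequence stabilises locally to a tiling fixed by `Φ^k`. -/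
theorem exists_periodic [Finite ι] (hflc : HasFLC Φ.tilingSpace) {Z : Set (Tile d M)}
    (hZ : Z ∈ Φ.tilingSpace) {k : ℕ} (hk : 1 ≤ k) {r : ℝ} (hr : 0 < r)
    (h : ∀ x, ‖x‖ < r → AgreeAt (Φ.app^[k] Z) Z x) :
    ∃ P ∈ Φ.tilingSpace, Φ.app^[k] P = P ∧ ∀ x, ‖x‖ < r → AgreeAt P Z x := by
  have hstep : ∀ j x, ‖x‖ < Φ.ratio ^ (k * j) * r →
      AgreeAt (Φ.app^[k * (j + 1)] Z) (Φ.app^[k * j] Z) x := by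
    intro j x hx
    rw [mul_add, mul_one, Function.iterate_add_apply]
    exact agreeAt_iterate_app_ball h (k * j) hx
  have hZj : ∀ j x, ‖x‖ < r → AgreeAt (Φ.app^[k * j] Z) Z x := by
    intro j x hx
    induction j with
    | zero => exact AgreeAt.refl _ _
    | succ j ih =>
      refine (hstep j x (hx.trans_le ?_)).trans ih
      exact le_mul_of_one_le_left hr.le (one_le_pow₀ Φ.one_lt_ratio.le)
  have hmem : ∀ j, Φ.app^[k * j] Z ∈ Φ.tilingSpace := fun j => iterate_app_mem hZ _
  obtain ⟨τ, hτ, h0⟩ := hZ.1.exists_mem 0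
  obtain ⟨P, hP, hlim⟩ := exists_limit hflc hmem (Set.finite_singleton τ) (R₀ := r)
    (Eventually.of_forall fun j =>
      ⟨τ, rfl, mem_ballPatch ((hZj j 0 (by simpa using hr) τ h0).2 hτ) h0 (by simpa using hr)⟩)
  refine ⟨P, hP, eq_of_agreeAt_of_mem (iterate_app_mem hP k) hP fun x => ?_, fun x hx => ?_⟩
  · have hpow : 0 < Φ.ratio ^ k := pow_pos Φ.ratio_pos k
    have h1 : ∀ᶠ j in (hyperfilter ℕ : Filter ℕ), ‖x‖ < Φ.ratio ^ (k * j) * r :=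
      (((tendsto_ratio_pow_mul hk).atTop_mul_const hr).eventually_gt_atTop _).filter_mono
        Nat.hyperfilter_le_atTop
    obtain ⟨j, hj, hx1, hx2⟩ := (h1.and ((hlim (‖x‖ + 1)).and
      (hlim (‖(Φ.ratio ^ k)⁻¹ • x‖ + 1)))).exists
    have h2 := agreeAt_iterate_app (Φ := Φ) (hx2 ((Φ.ratio ^ k)⁻¹ • x) (by linarith)) k
    rw [smul_inv_smul₀ hpow.ne', ← Function.iterate_add_apply,
      show k + k * j = k * (j + 1) by ring] at h2
    exact h2.symm.trans ((hstep j x hj).trans (hx1 x (by linarith)))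
  · obtain ⟨j, hj⟩ := (hlim r).exists
    exact (hj x hx).symm.trans (hZj j x hx)

/-- A branch pair either has a periodic first component, or its first component is a limit of points
on the branch rays of a periodic branch pair. -/
theorem periodic_or_mem_closure_branchRays [Finite ι] (hprim : Φ.IsPrimitive)
    (hflc : HasFLC Φ.tilingSpace) (hnonper : IsNonPeriodic Φ.tilingSpace) {T T' : Set (Tile d M)}
    (hTT' : (T, T') ∈ Φ.branchPairs) :
    Φ.IsSubstPeriodic T ∨ ∃ p ∈ Φ.periodicBranchPairs,
      T ∈ tilingClosure Φ.tilingSpace (Φ.branchRays p.1 p.2) := by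
  obtain ⟨hT, hT', h0, u, hu⟩ := mem_branchPairs_iff.1 hTT'
  have hun : ‖(u : Space d)‖ = 1 := norm_eq_of_mem_sphere u
  have hlam := Φ.ratio_pos
  have hpow : ∀ n : ℕ, 0 < Φ.ratio ^ n := fun n => pow_pos hlam n
  obtain ⟨S, hS, hS0, hSs⟩ := exists_iterate_app_eq hprim hflc hT
  obtain ⟨S', hS', hS0', hSs'⟩ := exists_iterate_app_eq hprim hflc hT'
  have hiter : ∀ (S : ℕ → Set (Tile d M)), (∀ n, Φ.app (S (n + 1)) = S n) →
      ∀ n m, Φ.app^[n] (S (m + n)) = S m := by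
    intro S hSs n
    induction n with
    | zero => intro m; rfl
    | succ n ih => intro m; rw [Function.iterate_succ_apply, ← add_assoc, hSs, ih]
  have hSn : ∀ n, Φ.app^[n] (S n) = T := fun n => by
    have := hiter S hSs n 0
    rwa [zero_add, hS0] at this
  have hSn' : ∀ n, Φ.app^[n] (S' n) = T' := fun n => by
    have := hiter S' hSs' n 0
    rwa [zero_add, hS0'] at this
  have hev : ∀ n x, Φ.EventuallyAgree (S n) (S' n) x ↔ Φ.EventuallyAgree T T' (Φ.ratio ^ n • x) := by
    intro n x
    rw [← eventuallyAgree_iterate_app n, hSn, hSn']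
  have hn0 : ∀ n, ¬ Φ.EventuallyAgree (S n) (S' n) 0 := fun n => by rwa [hev, smul_zero]
  have hnu : ∀ n x, 0 < inner ℝ x (u : Space d) → Φ.EventuallyAgree (S n) (S' n) x := by
    intro n x hx
    rw [hev]
    apply hu
    rw [real_inner_smul_left]
    exact mul_pos (hpow n) hx
  obtain ⟨c, hc, hagc⟩ := exists_agreeAt_halfSpace hprim hflc hnonper
  -- Chosen so that the displacement `z` below, of norm at most `δ / (1 - μ)` with `μ ≤ ratio⁻¹`, is
  -- at most `1 / 4`.
  set δ : ℝ := (1 - Φ.ratio⁻¹) / 4 with hδ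
  have hinv1 : Φ.ratio⁻¹ < 1 := inv_lt_one_of_one_lt₀ Φ.one_lt_ratio
  have hinv0 : 0 < Φ.ratio⁻¹ := inv_pos.2 hlam
  have hδpos : 0 < δ := by rw [hδ]; linarith
  have hδ4 : δ < 1 / 4 := by rw [hδ]; linarith
  have hshare : ∀ n, ∃ x : Space d, ‖x‖ < c + 3 ∧ AgreeAt (S n) (S' n) x := by
    intro n
    refine ⟨(c + 1) • (u : Space d), ?_, hagc _ (hS n) _ (hS' n) u hun (hnu n) _ ?_⟩
    · rw [norm_smul, hun, Real.norm_of_nonneg (by positivity)]; linarith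
    · rw [real_inner_smul_left, real_inner_self_eq_norm_sq, hun]; linarith
  obtain ⟨b, I, hI, hrec⟩ := exists_recurrence_pair hflc hS hS' hδpos hshare
  -- A negative component would match the origin of the `m`-th pair with a point of the open
  -- half-space of the `n`-th pair, where eventual agreement holds. Exchanging `n` and `m` excludes
  -- a positive one.
  have horth : ∀ n ∈ I, ∀ m ∈ I, inner ℝ (b m - b n) (u : Space d) = 0 := by
    have hle : ∀ n ∈ I, ∀ m ∈ I, 0 ≤ inner ℝ (b m - b n) (u : Space d) := by
      intro n hn m hm
      by_contra! hlt
      obtain ⟨-, hag⟩ := hrec n hn m hm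
      obtain ⟨h1, h2⟩ := hag 0 (by rw [norm_zero]; linarith)
      apply hn0 m
      rw [← eventuallyAgree_congr h1 h2, eventuallyAgree_translate]
      apply hnu
      rw [zero_sub, inner_neg_left]
      linarith
    intro n hn m hm
    have h1 := hle n hn m hm
    have h2 := hle m hm n hn
    rw [← neg_sub, inner_neg_left] at h2
    linarith
  obtain ⟨n, hn⟩ := (hyperfilter ℕ).nonempty_of_mem hI
  obtain ⟨m, hm, hnm⟩ : ∃ m ∈ I, n < m := by
    have : ∀ᶠ m in (hyperfilter ℕ : Filter ℕ), n < m :=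
      (eventually_gt_atTop n).filter_mono Nat.hyperfilter_le_atTop
    obtain ⟨m, hm, hnm⟩ := (Eventually.and (show ∀ᶠ m in (hyperfilter ℕ : Filter ℕ), m ∈ I from hI)
      this).exists
    exact ⟨m, hm, hnm⟩
  obtain ⟨k, rfl⟩ := Nat.exists_eq_add_of_le hnm.le
  have hk : 1 ≤ k := by omega
  set w : Space d := b (n + k) - b n with hw
  obtain ⟨hwδ, hagw⟩ := hrec n hn (n + k) hm
  set μ : ℝ := (Φ.ratio ^ k)⁻¹ with hμ
  have hμ0 : 0 < μ := inv_pos.2 (hpow k)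
  have hμle : μ ≤ Φ.ratio⁻¹ := by
    rw [hμ, ← inv_pow]
    exact pow_le_of_le_one hinv0.le hinv1.le (by omega)
  -- the displacement from the origin of the periodic tiling
  set z : Space d := (μ / (1 - μ)) • w with hz
  have hμ1 : 0 < 1 - μ := by linarith
  -- This equation makes `Φ^k` map `S (n + k) + z` to `S n + w + z`, which looks like `S (n + k) +
  -- z` near the origin.
  have hzw : Φ.ratio ^ k • z = w + z := by
    have h1 : Φ.ratio ^ k * (μ / (1 - μ)) = 1 + μ / (1 - μ) := by
      have : Φ.ratio ^ k * μ = 1 := mul_inv_cancel₀ (hpow k).ne'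
      rw [← mul_div_assoc, this]
      field_simp
      ring
    rw [hz, smul_smul, h1, add_smul, one_smul]
  have hznorm : ‖z‖ ≤ 1 / 4 := by
    rw [hz, norm_smul, Real.norm_of_nonneg (by positivity)]
    have h1 : μ / (1 - μ) * ‖w‖ ≤ 1 / (1 - μ) * δ := by
      apply mul_le_mul _ hwδ.le (norm_nonneg _) (by positivity)
      exact div_le_div_of_nonneg_right (by linarith) hμ1.le
    refine h1.trans ?_
    rw [one_div, inv_mul_le_iff₀ hμ1, hδ]
    linarith
  have hzu : inner ℝ z (u : Space d) = 0 := by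
    rw [hz, real_inner_smul_left, horth n hn _ hm, mul_zero]
  have hZ : ∀ (S : ℕ → Set (Tile d M)), (∀ n, S n ∈ Φ.tilingSpace) →
      (∀ n, Φ.app (S (n + 1)) = S n) →
      (∀ x, ‖x‖ < c + 3 - δ → AgreeAt (translate (S n) w) (S (n + k)) x) →
      ∃ P ∈ Φ.tilingSpace, Φ.app^[k] P = P ∧
        ∀ x, ‖x‖ < 1 → AgreeAt P (translate (S (n + k)) z) x := by
    intro S hS hSs hag
    refine exists_periodic hflc (translate_mem (hS _) z) hk one_pos fun x hx => ?_
    rw [iterate_app_translate, hiter S hSs, hzw, ← SubstTiling.translate_translate,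
      agreeAt_translate]
    apply hag
    linarith [norm_sub_le x z]
  obtain ⟨P, hP, hPk, hPag⟩ := hZ S hS hSs fun x hx => (hagw x hx).1
  obtain ⟨P', hP', hPk', hPag'⟩ := hZ S' hS' hSs' fun x hx => (hagw x hx).2
  have hevP : ∀ x, ‖x‖ < 1 →
      (Φ.EventuallyAgree P P' x ↔ Φ.EventuallyAgree (S (n + k)) (S' (n + k)) (x - z)) := by
    intro x hx
    rw [eventuallyAgree_congr (hPag x hx) (hPag' x hx), eventuallyAgree_translate]
  have hsmall : ∀ x : Space d, Tendsto (fun j => (Φ.ratio ^ (k * j))⁻¹ • x) atTop (𝓝 0) := by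
    intro x
    have := (tendsto_ratio_pow_mul (Φ := Φ) hk).inv_tendsto_atTop.smul_const x
    simpa using this
  have hPscale : ∀ j x, Φ.EventuallyAgree P P' ((Φ.ratio ^ (k * j))⁻¹ • x) ↔
      Φ.EventuallyAgree P P' x := by
    intro j x
    rw [← eventuallyAgree_of_periodic hPk hPk' j, smul_inv_smul₀ (hpow _).ne']
  have hPu : ∀ x, 0 < inner ℝ x (u : Space d) → Φ.EventuallyAgree P P' x := by
    intro x hx
    have h1 := ((hsmall x).norm).eventually (gt_mem_nhds (by simp : ‖(0 : Space d)‖ < 1))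
    obtain ⟨j, hj⟩ := h1.exists
    rw [← hPscale j, hevP _ hj]
    apply hnu
    rw [inner_sub_left, hzu, real_inner_smul_left, sub_zero]
    exact mul_pos (inv_pos.2 (hpow _)) hx
  -- The known disagreement is at `z`, which need not be the origin. Agreement at the origin would
  -- spread to a scaled-down copy of `z`, hence to `z` by self-similarity.
  have hP0 : ¬ Φ.EventuallyAgree P P' 0 := by
    intro h
    have h1 : ∀ᶠ x in 𝓝 (0 : Space d), Φ.EventuallyAgree P P' x :=
      (isOpen_eventuallyAgree hP hP').mem_nhds h
    obtain ⟨j, hj⟩ := ((hsmall z).eventually h1).exists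
    rw [hPscale, hevP z (by linarith), sub_self] at hj
    exact hn0 _ hj
  -- the location of the other members of the recurrent sequence in the periodic tiling
  set y : ℕ → Space d := fun i => z + (b (n + k) - b i) with hy
  have hynorm : ∀ i ∈ I, ‖y i‖ ≤ 1 / 2 := by
    intro i hi
    have h1 := norm_add_le z (b (n + k) - b i)
    have h2 := (hrec i hi _ hm).1
    simp only [hy]
    linarith
  have hyu : ∀ i ∈ I, inner ℝ (y i) (u : Space d) = 0 := by
    intro i hi
    simp only [hy]
    rw [inner_add_left, hzu, horth i hi _ hm, add_zero]
  have hPy : ∀ i ∈ I, ∀ x, ‖x‖ < 1 → AgreeAt P (translate (S i) (y i)) x ∧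
      AgreeAt P' (translate (S' i) (y i)) x := by
    intro i hi x hx
    have h1 := (hrec i hi _ hm).2 (x - z) (by linarith [norm_sub_le x z])
    have h2 := agreeAt_translate.2 h1.1
    have h3 := agreeAt_translate.2 h1.2
    rw [SubstTiling.translate_translate, add_comm] at h2 h3
    exact ⟨(hPag x hx).trans h2.symm, (hPag' x hx).trans h3.symm⟩
  have hPyn : ∀ i ∈ I, ¬ Φ.EventuallyAgree P P' (y i) := by
    intro i hi h
    have h1 := hPy i hi (y i) (by linarith [hynorm i hi])
    rw [eventuallyAgree_congr h1.1 h1.2, eventuallyAgree_translate, sub_self] at h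
    exact hn0 i h
  -- `Φ^i(P)` depends only on `i` modulo `k`; fixing the residue lets a single pair `(Q, Q')` serve
  -- along the ultrafilter.
  obtain ⟨e, -, he⟩ := (Ultrafilter.eventually_exists_mem_iff (Set.finite_Iio k)).1
    (Eventually.of_forall fun i => ⟨i % k, Nat.mod_lt i (by omega), rfl⟩ :
      ∀ᶠ i in (hyperfilter ℕ : Filter ℕ), ∃ e ∈ Set.Iio k, i % k = e)
  have hmodk : ∀ (P : Set (Tile d M)), Φ.app^[k] P = P → ∀ i, i % k = e →
      Φ.app^[i] P = Φ.app^[e] P := by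
    rintro P hP i rfl
    conv_lhs => rw [← Nat.mod_add_div i k, Function.iterate_add_apply, iterate_app_of_periodic hP]
  set Q := Φ.app^[e] P with hQ
  set Q' := Φ.app^[e] P' with hQ'
  have hQm : Q ∈ Φ.tilingSpace := iterate_app_mem hP e
  have hQm' : Q' ∈ Φ.tilingSpace := iterate_app_mem hP' e
  have hper : ∀ (P : Set (Tile d M)), Φ.app^[k] P = P → Φ.app^[k] (Φ.app^[e] P) = Φ.app^[e] P := by
    intro P hP
    rw [← Function.iterate_add_apply, add_comm, Function.iterate_add_apply, hP]
  have hQk : Φ.app^[k] Q = Q := hper P hPk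
  have hQk' : Φ.app^[k] Q' = Q' := hper P' hPk'
  have hQu : ∀ x, 0 < inner ℝ x (u : Space d) → Φ.EventuallyAgree Q Q' x := by
    intro x hx
    have h1 : x = Φ.ratio ^ e • (Φ.ratio ^ e)⁻¹ • x := by rw [smul_inv_smul₀ (hpow e).ne']
    rw [h1, eventuallyAgree_iterate_app]
    apply hPu
    rw [real_inner_smul_left]
    exact mul_pos (inv_pos.2 (hpow e)) hx
  have hQ0 : ¬ Φ.EventuallyAgree Q Q' 0 := by
    rw [← smul_zero (Φ.ratio ^ e), eventuallyAgree_iterate_app]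
    exact hP0
  -- Near the origin `S i` is `P` shifted by `y i`; applying `Φ^i` turns `S i` into `T` and inflates
  -- the ball.
  have hTQ : ∀ i ∈ I, i % k = e → ∀ x, ‖x‖ < Φ.ratio ^ i * (1 / 2) →
      AgreeAt T (shift Q (Φ.ratio ^ i • y i)) x := by
    intro i hi hie x hx
    have h1 : ∀ x, ‖x‖ < 1 / 2 → AgreeAt (S i) (translate P (-y i)) x := by
      intro x hx
      have h2 := (hPy i hi (x + y i) (by linarith [norm_add_le x (y i), hynorm i hi])).1
      have h3 := agreeAt_translate (v := -y i) (x := x) |>.2 (by rwa [sub_neg_eq_add])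
      rw [SubstTiling.translate_translate, add_neg_cancel, SubstTiling.translate_zero] at h3
      exact h3.symm
    have h2 := agreeAt_iterate_app_ball h1 i hx
    rwa [hSn, iterate_app_translate, hmodk P hPk i hie, smul_neg, ← shift_eq] at h2
  have hgood : ∀ᶠ i in (hyperfilter ℕ : Filter ℕ), i ∈ I ∧ i % k = e :=
    Eventually.and hI he
  have hbig : ∀ C : ℝ, ∀ᶠ i in (hyperfilter ℕ : Filter ℕ), C < Φ.ratio ^ i * (1 / 2) := fun C =>
    (((tendsto_pow_atTop_atTop_of_one_lt Φ.one_lt_ratio).atTop_mul_const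
      one_half_pos).eventually_gt_atTop C).filter_mono Nat.hyperfilter_le_atTop
  by_cases hy0 : ∀ᶠ i in (hyperfilter ℕ : Filter ℕ), y i = 0
  · left
    have hTeq : T = Q := by
      refine eq_of_agreeAt_of_mem hT hQm fun x => ?_
      obtain ⟨i, hi0, ⟨hi, hie⟩, hx⟩ := (hy0.and (hgood.and (hbig ‖x‖))).exists
      have := hTQ i hi hie x hx
      rwa [hi0, smul_zero, shift_eq, neg_zero, SubstTiling.translate_zero] at this
    rw [hTeq]
    exact ⟨k, hk, hQk⟩
  · right
    rw [← Ultrafilter.eventually_not] at hy0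
    refine ⟨(Q, Q'), ⟨mem_branchPairs_iff.2 ⟨hQm, hQm', hQ0, u, hQu⟩, k, hk, hQk⟩, hT, fun ε hε => ?_⟩
    obtain ⟨i, hi0, ⟨hi, hie⟩, hiε⟩ := (hy0.and (hgood.and (hbig ε⁻¹))).exists
    have hyi : 0 < ‖y i‖ := norm_pos_iff.2 hi0
    let v : Direction d := ⟨‖y i‖⁻¹ • y i, by
      rw [mem_sphere_zero_iff_norm, norm_smul, norm_inv, norm_norm, inv_mul_cancel₀ hyi.ne']⟩
    have hv : ∀ s : ℝ, (s * ‖y i‖) • (v : Space d) = s • y i := by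
      intro s
      change (s * ‖y i‖) • ‖y i‖⁻¹ • y i = s • y i
      rw [mul_smul, smul_inv_smul₀ hyi.ne']
    refine ⟨shift Q (Φ.ratio ^ i • y i), ⟨v, ?_, Φ.ratio ^ i * ‖y i‖, by positivity, ?_⟩, ?_⟩
    · refine mem_branchDirections hQm hQm' hQu ?_
        (t := fun j => Φ.ratio ^ (k * j) * (Φ.ratio ^ i * ‖y i‖)) ?_ ?_
      · change inner ℝ (‖y i‖⁻¹ • y i) (u : Space d) = 0
        rw [real_inner_smul_left, hyu i hi, mul_zero]
      · exact (tendsto_ratio_pow_mul hk).atTop_mul_const (mul_pos (hpow i) hyi)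
      · intro j
        rw [mul_smul, hv, eventuallyAgree_of_periodic hQk hQk', hQ, hQ', ← hmodk P hPk i hie,
          ← hmodk P' hPk' i hie, eventuallyAgree_iterate_app]
        exact hPyn i hi
    · rw [hv]
    · refine (tilingDist_le (by positivity) (close_of_agreeAt ((inv_pos.2 hε).trans hiε)
        (hTQ i hi hie))).trans_lt ?_
      exact inv_lt_of_inv_lt₀ hε hiε

end SelfSimilarSubstitution

namespace SelfSimilarSubstitution

open SubstTiling

variable {d : ℕ} {M ι : Type*} {Φ : SelfSimilarSubstitution d M ι}

/-! ### Limits of branch pairs -/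

theorem exists_tendsto_direction (u : ℕ → Direction d) :
    ∃ a, Tendsto u (hyperfilter ℕ : Filter ℕ) (𝓝 a) := by
  obtain ⟨a, -, ha⟩ := (isCompact_univ (X := Direction d)).ultrafilter_le_nhds
    ((hyperfilter ℕ).map u) (by simp)
  exact ⟨a, ha⟩

/-- A limit of first components of pairs of tilings that are stably equivalent on a half-space is
again the first component of such a pair; the directions of the half-spaces and of rays on which the
pairs are not stably equivalent pass to the limit. -/
theorem exists_limit_pair [Finite ι] (hprim : Φ.IsPrimitive) (hflc : HasFLC Φ.tilingSpace)
    (hnonper : IsNonPeriodic Φ.tilingSpace) {X : Set (Tile d M)} (hX : X ∈ Φ.tilingSpace)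
    {s : Set (Direction d × Direction d)} (hs : IsClosed s) {W : Set ℝ}
    (h : ∀ ε : ℝ, 0 < ε → ∃ Y ∈ Φ.tilingSpace, ∃ Y' ∈ Φ.tilingSpace, ∃ q ∈ s,
      (∀ x, 0 < inner ℝ x (q.1 : Space d) → Φ.EventuallyAgree Y Y' x) ∧
      (∀ t ∈ W, ¬ Φ.EventuallyAgree Y Y' (t • (q.2 : Space d))) ∧ tilingDist X Y < ε) :
    ∃ X' ∈ Φ.tilingSpace, ∃ q ∈ s,
      (∀ x, 0 < inner ℝ x (q.1 : Space d) → Φ.EventuallyAgree X X' x) ∧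
      (∀ t ∈ W, ¬ Φ.EventuallyAgree X X' (t • (q.2 : Space d))) := by
  -- The `+ 2` absorbs the two losses of at most `1`, one in extracting agreement from closeness and
  -- one in translating by `-w`, so that agreement holds on the ball of radius `n`.
  choose Y hY Y' hY' q hq hqu hqW hdist using fun n : ℕ =>
    h (1 / ((n : ℝ) + 2)) (by positivity)
  obtain ⟨c, hc, hagc⟩ := exists_agreeAt_halfSpace hprim hflc hnonper
  have hclose : ∀ n : ℕ, ∃ w : Space d, ‖w‖ < 1 / ((n : ℝ) + 2) ∧
      ∀ x, ‖x‖ < (n : ℝ) → AgreeAt X (translate (Y n) (-w)) x := by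
    intro n
    have hn : (0 : ℝ) ≤ n := Nat.cast_nonneg n
    have hle : 1 / ((n : ℝ) + 2) ≤ 1 := by
      rw [div_le_one (by positivity)]; linarith
    obtain ⟨δ, hδ, hδn, hcl⟩ := exists_close_of_tilingDist_lt hle (hdist n)
    obtain ⟨w, hw, hag⟩ := exists_agreeAt_of_close hcl
    refine ⟨w, hw.trans hδn, fun x hx => ?_⟩
    have h1 : (n : ℝ) + 2 < 1 / δ := by
      rw [lt_div_iff₀ hδ]
      rw [lt_div_iff₀ (by positivity)] at hδn
      linarith
    have h2 := agreeAt_translate (v := -w) (x := x) |>.2 (hag (x - -w) (by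
      have := norm_sub_le x (-w)
      rw [norm_neg] at this
      linarith))
    rwa [SubstTiling.translate_translate, add_neg_cancel, SubstTiling.translate_zero] at h2
  choose w hw hag using hclose
  set S' : ℕ → Set (Tile d M) := fun n => translate (Y' n) (-w n) with hS'
  have hev : ∀ n x, Φ.EventuallyAgree (translate (Y n) (-w n)) (S' n) x ↔
      Φ.EventuallyAgree (Y n) (Y' n) (x + w n) := by
    intro n x
    rw [hS', eventuallyAgree_translate, sub_neg_eq_add]
  have hw0 : Tendsto w (hyperfilter ℕ : Filter ℕ) (𝓝 0) := by
    refine Tendsto.mono_left (squeeze_zero_norm (fun n => (hw n).le) ?_) Nat.hyperfilter_le_atTop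
    have h1 : Tendsto (fun n : ℕ => (n : ℝ) + 2) atTop atTop :=
      tendsto_atTop_add_const_right _ _ tendsto_natCast_atTop_atTop
    simp only [one_div]
    exact h1.inv_tendsto_atTop
  have hnat : ∀ C : ℝ, ∀ᶠ n : ℕ in (hyperfilter ℕ : Filter ℕ), C < n := fun C =>
    (tendsto_natCast_atTop_atTop.eventually_gt_atTop C).filter_mono Nat.hyperfilter_le_atTop
  -- Nothing is assumed about convergence of the partners. Beyond distance `c` in the half-space a
  -- partner agrees with `Y n`, hence with `X` up to the shift, so it contains one of finitely many
  -- tiles of `X`.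
  have hpin : ∀ᶠ n in (hyperfilter ℕ : Filter ℕ), ∃ τ ∈ ballPatch (c + 2) X,
      τ ∈ ballPatch (c + 2) (S' n) := by
    filter_upwards [hnat (c + 2)] with n hn
    have hun : ‖((q n).1 : Space d)‖ = 1 := norm_eq_of_mem_sphere _
    have h1 := hagc _ (hY n) _ (hY' n) _ hun (hqu n) ((c + 1) • ((q n).1 : Space d)) (by
      rw [real_inner_smul_left, real_inner_self_eq_norm_sq, hun]; linarith)
    set x : Space d := (c + 1) • ((q n).1 : Space d) + -w n with hx
    have h2 : AgreeAt (translate (Y n) (-w n)) (S' n) x := by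
      rw [hS', agreeAt_translate, hx, add_sub_cancel_right]
      exact h1
    have hxn : ‖x‖ < c + 2 := by
      have h3 := norm_add_le ((c + 1) • ((q n).1 : Space d)) (-w n)
      rw [norm_smul, hun, Real.norm_of_nonneg (by positivity), norm_neg] at h3
      have h4 : 1 / ((n : ℝ) + 2) < 1 := by
        rw [div_lt_one (by positivity)]
        linarith
      linarith [hw n]
    obtain ⟨τ, hτ, hxτ⟩ := hX.1.exists_mem x
    have h5 := (hag n x (hxn.trans hn) τ hxτ).1 hτ
    exact ⟨τ, mem_ballPatch hτ hxτ hxn, mem_ballPatch ((h2 τ hxτ).1 h5) hxτ hxn⟩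
  obtain ⟨X', hX', hlim⟩ := exists_limit hflc (fun n => translate_mem (hY' n) _)
    (finite_ballPatch hX (c + 2)) hpin
  have hevX : ∀ R : ℝ, ∀ᶠ n in (hyperfilter ℕ : Filter ℕ), ∀ x, ‖x‖ < R →
      (Φ.EventuallyAgree X X' x ↔ Φ.EventuallyAgree (Y n) (Y' n) (x + w n)) := by
    intro R
    filter_upwards [hnat R, hlim R] with n hn hn' x hx
    rw [← hev, eventuallyAgree_congr (hag n x (hx.trans hn)) (hn' x hx).symm]
  obtain ⟨u, hu⟩ := exists_tendsto_direction fun n => (q n).1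
  obtain ⟨v, hv⟩ := exists_tendsto_direction fun n => (q n).2
  have hu' : Tendsto (fun n => ((q n).1 : Space d)) (hyperfilter ℕ : Filter ℕ) (𝓝 (u : Space d)) :=
    (continuous_subtype_val.tendsto u).comp hu
  have hv' : Tendsto (fun n => ((q n).2 : Space d)) (hyperfilter ℕ : Filter ℕ) (𝓝 (v : Space d)) :=
    (continuous_subtype_val.tendsto v).comp hv
  refine ⟨X', hX', (u, v), hs.mem_of_tendsto (hu.prodMk_nhds hv) (Eventually.of_forall hq), ?_, ?_⟩
  · intro x hx
    have h1 : Tendsto (fun n => inner ℝ (x + w n) ((q n).1 : Space d)) (hyperfilter ℕ : Filter ℕ)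
        (𝓝 (inner ℝ x (u : Space d))) := by
      have := (hw0.const_add x).inner (𝕜 := ℝ) hu'
      rwa [add_zero] at this
    obtain ⟨n, hn, hn'⟩ := ((h1.eventually (lt_mem_nhds hx)).and (hevX (‖x‖ + 1))).exists
    exact (hn' x (by linarith)).2 (hqu n _ hn)
  -- Agreement is open, so agreement of the limit pair at `t • v` would hold at the nearby points `t
  -- • v_n - w n`, where the approximating pairs disagree.
  · intro t ht hcon
    have hz : Tendsto (fun n => t • ((q n).2 : Space d) - w n) (hyperfilter ℕ : Filter ℕ)
        (𝓝 (t • (v : Space d))) := by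
      have := (hv'.const_smul t).sub hw0
      rwa [sub_zero] at this
    have h1 : ∀ᶠ x in 𝓝 (t • (v : Space d)), Φ.EventuallyAgree X X' x :=
      (isOpen_eventuallyAgree hX hX').mem_nhds hcon
    have h2 : ∀ᶠ x in 𝓝 (t • (v : Space d)), ‖x‖ < ‖t • (v : Space d)‖ + 1 :=
      continuous_norm.continuousAt.eventually (gt_mem_nhds (by simp))
    obtain ⟨n, ⟨hn1, hn2⟩, hn3⟩ := ((hz.eventually (h1.and h2)).and
      (hevX (‖t • (v : Space d)‖ + 1))).exists
    have h3 := (hn3 _ hn2).1 hn1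
    rw [sub_add_cancel] at h3
    exact hqW n t ht h3

/-! ### Sectors in the plane -/

/-- A connected set of directions in the plane that contains an open half-circle contains one of the
open half-circles adjacent to any of its frontier points. -/
theorem exists_hemisphere_subset {S : Set (Direction 2)} (hS : IsPreconnected S) {u v : Direction 2}
    (hu : hemisphere u ⊆ S) (hv : v ∈ frontier S) :
    ∃ e : Direction 2, inner ℝ (v : Space 2) (e : Space 2) = 0 ∧ hemisphere e ⊆ S := by
  have hsq : ∀ x : Direction 2, (x : Space 2) 0 ^ 2 + (x : Space 2) 1 ^ 2 = 1 := by
    intro x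
    have h1 := EuclideanSpace.norm_sq_eq (x : Space 2)
    rw [norm_eq_of_mem_sphere x, Fin.sum_univ_two] at h1
    simp only [Real.norm_eq_abs, sq_abs] at h1
    linarith
  have hinner : ∀ x y : Space 2, inner ℝ x y = x 0 * y 0 + x 1 * y 1 := by
    intro x y
    rw [PiLp.inner_apply, Fin.sum_univ_two]
    simp [mul_comm]
  -- The quarter turn of `v`. If `S` misses a point on each side of the line through `v`, the chord
  -- joining these two points separates `S`.
  let e : Direction 2 := ⟨!₂[-(v : Space 2) 1, (v : Space 2) 0], by
    rw [mem_sphere_zero_iff_norm, ← sq_eq_sq₀ (norm_nonneg _) zero_le_one,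
      EuclideanSpace.norm_sq_eq, Fin.sum_univ_two]
    have := hsq v
    simp only [Real.norm_eq_abs, sq_abs]
    simp
    linarith⟩
  have he0 : (e : Space 2) 0 = -(v : Space 2) 1 := rfl
  have he1 : (e : Space 2) 1 = (v : Space 2) 0 := rfl
  have hve : inner ℝ (v : Space 2) (e : Space 2) = 0 := by
    rw [hinner, he0, he1]; ring
  by_cases h1 : hemisphere e ⊆ S
  · exact ⟨e, hve, h1⟩
  by_cases h2 : hemisphere (-e) ⊆ S
  · refine ⟨-e, ?_, h2⟩
    rw [coe_neg_sphere, inner_neg_right, hve, neg_zero]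
  exfalso
  obtain ⟨a, ha, haS⟩ := Set.not_subset.1 h1
  obtain ⟨b, hb, hbS⟩ := Set.not_subset.1 h2
  -- coordinates in the frame `(v, e)`
  set p : Direction 2 → ℝ := fun w => inner ℝ (w : Space 2) (v : Space 2) with hp
  set r : Direction 2 → ℝ := fun w => inner ℝ (w : Space 2) (e : Space 2) with hr
  have hpr : ∀ w, p w ^ 2 + r w ^ 2 = 1 := by
    intro w
    simp only [hp, hr, hinner, he0, he1]
    have h3 := hsq w
    have h4 := hsq v
    linear_combination ((v : Space 2) 0 ^ 2 + (v : Space 2) 1 ^ 2) * h3 + h4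
  have hinj : ∀ w w', p w = p w' → r w = r w' → w = w' := by
    intro w w' h3 h4
    simp only [hp, hr, hinner, he0, he1] at h3 h4
    have h5 := hsq v
    apply Subtype.ext
    ext i
    fin_cases i
    · change (w : Space 2) 0 = (w' : Space 2) 0
      linear_combination (v : Space 2) 0 * h3 - (v : Space 2) 1 * h4 -
        ((w : Space 2) 0 - (w' : Space 2) 0) * h5
    · change (w : Space 2) 1 = (w' : Space 2) 1
      linear_combination (v : Space 2) 1 * h3 + (v : Space 2) 0 * h4 -
        ((w : Space 2) 1 - (w' : Space 2) 1) * h5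
  have hra : 0 < r a := ha
  have hrb : r b < 0 := by
    have h3 : 0 < inner ℝ (b : Space 2) ((-e : Direction 2) : Space 2) := hb
    rw [coe_neg_sphere, inner_neg_right] at h3
    simp only [hr]
    linarith
  -- An affine function vanishing on the line through `a` and `b`. That line meets the circle only
  -- at these two points, so `F` has no zero on `S`.
  set F : Direction 2 → ℝ := fun w => (p w - p a) * (r b - r a) - (r w - r a) * (p b - p a) with hF
  have hFcont : Continuous F := by
    have h3 : Continuous p := continuous_subtype_val.inner continuous_const
    have h4 : Continuous r := continuous_subtype_val.inner continuous_const
    fun_prop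
  have hFne : ∀ w ∈ S, F w ≠ 0 := by
    intro w hw h0
    have hwa : w ≠ a := fun h => haS (h ▸ hw)
    have hwb : w ≠ b := fun h => hbS (h ▸ hw)
    have e1 := hpr w
    have e2 := hpr a
    have e3 := hpr b
    simp only [hF] at h0
    have hd : r b - r a ≠ 0 := by linarith
    obtain ⟨t, ht⟩ : ∃ t, r w - r a = t * (r b - r a) := ⟨(r w - r a) / (r b - r a), by field_simp⟩
    have ht' : p w - p a = t * (p b - p a) := by
      apply mul_right_cancel₀ hd
      rw [ht] at h0
      linear_combination h0
    have key : t * (t - 1) * ((p b - p a) ^ 2 + (r b - r a) ^ 2) = 0 := by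
      have g1 : p w = p a + t * (p b - p a) := by linarith
      have g2 : r w = r a + t * (r b - r a) := by linarith
      rw [g1, g2] at e1
      linear_combination e1 - (1 - t) * e2 - t * e3
    have hpos : (p b - p a) ^ 2 + (r b - r a) ^ 2 ≠ 0 := by positivity
    rcases mul_eq_zero.1 ((mul_eq_zero.1 key).resolve_right hpos) with h | h
    · exact hwa (hinj w a (by rw [h] at ht'; linarith) (by rw [h] at ht; linarith))
    · have h' : t = 1 := by linarith
      exact hwb (hinj w b (by rw [h'] at ht'; linarith) (by rw [h'] at ht; linarith))
  have hpa : p a < 1 ∧ -1 < p a := by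
    constructor <;> nlinarith [hpr a, mul_pos hra hra]
  have hpb : p b < 1 ∧ -1 < p b := by
    constructor <;> nlinarith [hpr b, mul_pos_of_neg_of_neg hrb hrb]
  have hpv : p v = 1 := by
    simp only [hp]
    rw [real_inner_self_eq_norm_sq, norm_eq_of_mem_sphere v]; norm_num
  have hrv : r v = 0 := hve
  have hpv' : p (-v) = -1 := by
    simp only [hp] at hpv ⊢
    rw [coe_neg_sphere, inner_neg_left, hpv]
  have hrv' : r (-v) = 0 := by
    simp only [hr]
    rw [coe_neg_sphere, inner_neg_left, hve, neg_zero]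
  have hFv : F v < 0 := by
    simp only [hF, hpv, hrv]
    nlinarith [mul_pos (sub_pos.2 hpa.1) (neg_pos.2 hrb), mul_pos hra (sub_pos.2 hpb.1)]
  have hFv' : 0 < F (-v) := by
    simp only [hF, hpv', hrv']
    nlinarith [mul_pos (neg_lt_iff_pos_add.1 hpa.2) (neg_pos.2 hrb),
      mul_pos hra (neg_lt_iff_pos_add.1 hpb.2)]
  -- A frontier point avoids the open half-circle, so `-v` lies in its closure. Thus `S` accumulates
  -- at both `v` and `-v`, where `F` has opposite signs.
  have hvu : inner ℝ (v : Space 2) (u : Space 2) ≤ 0 := by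
    by_contra! h
    exact hv.2 (interior_maximal hu (isOpen_hemisphere u) h)
  have hvcl : -v ∈ closure (hemisphere u) := by
    rcases hvu.lt_or_eq with h | h
    · apply subset_closure
      change 0 < inner ℝ ((-v : Direction 2) : Space 2) (u : Space 2)
      rw [coe_neg_sphere, inner_neg_left]
      linarith
    · apply mem_closure_hemisphere
      rw [coe_neg_sphere, inner_neg_left, h, neg_zero]
  obtain ⟨x, hx, hxS⟩ := mem_closure_iff.1 hv.1 _ (isOpen_Iio.preimage hFcont) hFv
  obtain ⟨y, hy, hyS⟩ := mem_closure_iff.1 hvcl _ (isOpen_Ioi.preimage hFcont) hFv'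
  obtain ⟨z, hzS, hz⟩ := hS.intermediate_value hxS (hu hyS) hFcont.continuousOn
    (⟨le_of_lt hx, le_of_lt hy⟩ : (0 : ℝ) ∈ Set.Icc (F x) (F y))
  exact hFne z hzS hz

theorem stableOnHalfSpace_of_hemisphere_subset {T T' : Set (Tile d M)} {e : Direction d}
    (h : hemisphere e ⊆ Φ.stableDirections T T') : Φ.StableOnHalfSpace T T' e := by
  intro x hx
  have hne : x ≠ 0 := by
    rintro rfl
    simp at hx
  have hn : 0 < ‖x‖ := norm_pos_iff.2 hne
  let w : Direction d := ⟨‖x‖⁻¹ • x, by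
    rw [mem_sphere_zero_iff_norm, norm_smul, norm_inv, norm_norm, inv_mul_cancel₀ hn.ne']⟩
  have hw : w ∈ hemisphere e := by
    change 0 < inner ℝ (‖x‖⁻¹ • x) (e : Space d)
    rw [real_inner_smul_left]
    positivity
  have h1 := h hw ‖x‖ hn
  have h2 : ‖x‖ • (w : Space d) = x := smul_inv_smul₀ hn.ne' x
  rwa [h2] at h1

variable {Φ : SelfSimilarSubstitution 2 M ι}

/-- The pair disagrees at the origin and arbitrarily far out on the ray, so non-collapsing fills in
all points between; the half-plane comes from the planar statement on sectors. -/
theorem exists_halfPlane_of_mem_branchDirections [Finite ι] (hnc : Φ.NonCollapsing)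
    {T T' : Set (Tile 2 M)} (hTT' : (T, T') ∈ Φ.branchPairs) {v : Direction 2}
    (hv : v ∈ Φ.branchDirections T T') :
    ∃ e : Direction 2, inner ℝ (v : Space 2) (e : Space 2) = 0 ∧
      (∀ x, 0 < inner ℝ x (e : Space 2) → Φ.EventuallyAgree T T' x) ∧
      ∀ t : ℝ, 0 ≤ t → ¬ Φ.EventuallyAgree T T' (t • (v : Space 2)) := by
  obtain ⟨hT, hT', h0, -⟩ := mem_branchPairs_iff.1 hTT'
  obtain ⟨⟨S, hS, hvS⟩, t, ht, hnt⟩ := hv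
  obtain ⟨u, hu, rfl⟩ := id hS
  obtain ⟨e, hve, he⟩ := exists_hemisphere_subset isPreconnected_connectedComponentIn
    (hemisphere_subset_component hu) hvS
  refine ⟨e, hve, (stableOnHalfSpace_iff hT hT').1
    (stableOnHalfSpace_of_hemisphere_subset (he.trans (connectedComponentIn_subset _ _))), ?_⟩
  intro s hs
  obtain ⟨i, hi⟩ := (ht.eventually_gt_atTop s).exists
  rw [← stablyEquiv_shift_iff hT hT']
  refine hnc T T' hTT' _ hS v hvS 0 (t i) le_rfl (hs.trans_lt hi) ?_ (hnt i) s ⟨hs, hi.le⟩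
  rwa [stablyEquiv_shift_iff hT hT', zero_smul]

/-! ### The branch locus -/

theorem mem_tilingClosure {Ω A : Set (Set (Tile d M))} {X : Set (Tile d M)} (hX : X ∈ Ω)
    (hA : X ∈ A) : X ∈ tilingClosure Ω A := by
  refine ⟨hX, fun ε hε => ⟨X, hA, ?_⟩⟩
  have h1 : 0 < 2 / ε := by positivity
  refine (tilingDist_le (inv_pos.2 h1) (close_of_agreeAt h1 fun x _ => AgreeAt.refl X x)).trans_lt ?_
  rw [inv_div]
  linarith

theorem tilingClosure_mono {Ω A B : Set (Set (Tile d M))} (h : A ⊆ B) :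
    tilingClosure Ω A ⊆ tilingClosure Ω B :=
  fun _ hX => ⟨hX.1, fun ε hε => (hX.2 ε hε).imp fun _ hY => ⟨h hY.1, hY.2⟩⟩

/-- Disagreement at the origin alone (`W = {0}`) is kept in the limit: it suffices that `X` belongs
to some branch pair, since `{X}` is part of the locus when `X` is periodic. -/
theorem branchLocus_subset [Finite ι] (hprim : Φ.IsPrimitive) (hflc : HasFLC Φ.tilingSpace)
    (hnonper : IsNonPeriodic Φ.tilingSpace) (hnc : Φ.NonCollapsing) :
    Φ.branchLocus ⊆ Φ.periodicBranchLocus := by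
  intro X hX
  obtain ⟨⟨T, T'⟩, hTT', hX, hXcl⟩ := Set.mem_iUnion₂.1 hX
  obtain ⟨hT, hT', h0, u, hu⟩ := mem_branchPairs_iff.1 hTT'
  obtain ⟨X', hX', q, -, hqu, hq0⟩ := exists_limit_pair hprim hflc hnonper hX isClosed_univ
    (W := {0}) fun ε hε => by
      obtain ⟨Y, hY, hdist⟩ := hXcl ε hε
      rcases hY with rfl | ⟨v, hv, s, hs, rfl⟩
      · refine ⟨_, hT, T', hT', (u, u), trivial, hu, ?_, hdist⟩
        rintro t rfl
        rwa [zero_smul]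
      · obtain ⟨e, hve, he, hvn⟩ := exists_halfPlane_of_mem_branchDirections hnc hTT' hv
        refine ⟨_, shift_mem hT _, _, shift_mem hT' (s • (v : Space 2)), (e, v), trivial, ?_, ?_,
          hdist⟩
        · intro x hx
          rw [eventuallyAgree_shift]
          apply he
          rw [inner_add_left, real_inner_smul_left, hve, mul_zero, add_zero]
          exact hx
        · rintro t rfl
          rw [eventuallyAgree_shift, zero_smul, zero_add]
          exact hvn s hs
  have hXX' : (X, X') ∈ Φ.branchPairs :=
    mem_branchPairs_iff.2 ⟨hX, hX', by simpa using hq0 0 rfl, q.1, hqu⟩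
  rcases periodic_or_mem_closure_branchRays hprim hflc hnonper hXX' with hper | ⟨p, hp, hXp⟩
  · exact Set.mem_iUnion₂.2 ⟨_, ⟨hXX', hper⟩, mem_tilingClosure hX (Set.mem_insert _ _)⟩
  · exact Set.mem_iUnion₂.2 ⟨p, hp, tilingClosure_mono (Set.subset_insert _ _) hXp⟩

/-- Here the limit must retain a branch direction, so disagreement on the whole ray and
orthogonality of ray and half-plane normal are carried along. A periodic `X` is then the starting
point of a ray of its own pair. -/
theorem branchRayLocus_subset [Finite ι] (hprim : Φ.IsPrimitive) (hflc : HasFLC Φ.tilingSpace)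
    (hnonper : IsNonPeriodic Φ.tilingSpace) (hnc : Φ.NonCollapsing) :
    Φ.branchRayLocus ⊆ Φ.periodicBranchRayLocus := by
  intro X hX
  obtain ⟨⟨T, T'⟩, hTT', hX, hXcl⟩ := Set.mem_iUnion₂.1 hX
  obtain ⟨hT, hT', -⟩ := mem_branchPairs_iff.1 hTT'
  have hclosed : IsClosed {q : Direction 2 × Direction 2 |
      inner ℝ (q.2 : Space 2) (q.1 : Space 2) = 0} :=
    isClosed_eq ((continuous_subtype_val.comp continuous_snd).inner
      (continuous_subtype_val.comp continuous_fst)) continuous_const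
  obtain ⟨X', hX', ⟨e, v⟩, hve, he, hvn⟩ := exists_limit_pair hprim hflc hnonper hX hclosed
    (W := Set.Ici 0) fun ε hε => by
      obtain ⟨_, ⟨v, hv, s, hs, rfl⟩, hdist⟩ := hXcl ε hε
      obtain ⟨e, hve, he, hvn⟩ := exists_halfPlane_of_mem_branchDirections hnc hTT' hv
      refine ⟨_, shift_mem hT _, _, shift_mem hT' (s • (v : Space 2)), (e, v), hve, ?_, ?_, hdist⟩
      · intro x hx
        rw [eventuallyAgree_shift]
        apply he
        rw [inner_add_left, real_inner_smul_left, hve, mul_zero, add_zero]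
        exact hx
      · intro t ht
        rw [eventuallyAgree_shift, ← add_smul]
        exact hvn _ (add_nonneg ht hs)
  have hXX' : (X, X') ∈ Φ.branchPairs :=
    mem_branchPairs_iff.2 ⟨hX, hX', by simpa using hvn 0 Set.self_mem_Ici, e, he⟩
  rcases periodic_or_mem_closure_branchRays hprim hflc hnonper hXX' with hper | ⟨p, hp, hXp⟩
  · refine Set.mem_iUnion₂.2 ⟨_, ⟨hXX', hper⟩, mem_tilingClosure hX ⟨v, ?_, 0, le_rfl, ?_⟩⟩
    · exact mem_branchDirections hX hX' he hve tendsto_natCast_atTop_atTop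
        fun i => hvn i (Set.mem_Ici.2 (Nat.cast_nonneg i))
    · rw [zero_smul, shift_eq, neg_zero, SubstTiling.translate_zero]
  · exact Set.mem_iUnion₂.2 ⟨p, hp, hXp⟩

end SelfSimilarSubstitution

theorem mainTheorem10 {M ι : Type*} [Finite ι] (Φ : SelfSimilarSubstitution 2 M ι)
    (hpoly : ∀ i, SubstTiling.IsConvexPolygon (Φ.proto i).support)
    (hprim : Φ.IsPrimitive)
    (hflc : SubstTiling.HasFLC Φ.tilingSpace)
    (hnonper : SubstTiling.IsNonPeriodic Φ.tilingSpace)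
    (hnc : Φ.NonCollapsing) :
    Φ.periodicBranchLocus = Φ.branchLocus ∧
      Φ.periodicBranchRayLocus = Φ.branchRayLocus := by
  have hsub : Φ.periodicBranchPairs ⊆ Φ.branchPairs := fun p hp => hp.1
  exact ⟨(Set.biUnion_subset_biUnion_left hsub).antisymm
      (Φ.branchLocus_subset hprim hflc hnonper hnc),
    (Set.biUnion_subset_biUnion_left hsub).antisymm
      (Φ.branchRayLocus_subset hprim hflc hnonper hnc)⟩
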